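/- **Setting.** Let $\Omega_0$ be a finite nonempty totally ordered set with maximal and minimal elements "plus" and "minus". Let $\mathbb L$ be a countable set with a transitive action $(\tau_i)_{i\in\mathbb Z^d}$ of $\mathbb Z^d$ (for instance $\mathbb L=\mathbb Z^d$) and a base point $0\in\mathbb L$. Put $\Omega=\Omega_0^{\mathbb L}$, with the product topology, product $\sigma$-algebra $\mathcal F$ and coordinatewise order; $+$ and $-$ also denote the maximal and minimal configurations. Translations act by $(\tau_i\omega)_x=\omega_{\tau_{-i}x}$. For $D\subset\mathbb L$, $\mathcal F_D$ is the $\sigma$-algebra generated by the spins in $D$. A function $f:\Omega\to\mathbb R$ is *local* if it depends on finitely many spins. A *specification* is a family $\gamma=(\gamma_\Lambda)$, $\Lambda\subset\mathbb L$ finite, of probability kernels $\gamma_\Lambda(\cdot\,|\,\omega)$ on $\Omega$ such that $\gamma_\Lambda(A|\cdot)$ is $\mathcal F_{\Lambda^c}$-measurable for $A\in\mathcal F$, $\gamma_\Lambda(B|\omega)=\mathbf 1_B(\omega)$ for $B\in\mathcal F_{\Lambda^c}$, and $\gamma_{\Lambda'}\gamma_\Lambda=\gamma_{\Lambda'}$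 for $\Lambda\subset\Lambda'$. Write $\gamma_\Lambda f(\omega)=\int f\,d\gamma_\Lambda(\cdot|\omega)$. A probability measure $\mu$ is *consistent* with $\gamma$, written $\mu\in\mathcal G(\gamma)$, if $\mu\gamma_\Lambda=\mu$ for all finite $\Lambda$. Let $\Omega_\gamma$ be the set of configurations at which $\gamma_\Lambda f$ is continuous for every finite $\Lambda$ and every local $f$; $\mu$ is *almost quasilocal* if $\mu\in\mathcal G(\gamma)$ and $\mu(\Omega_\gamma)=1$ for some specification $\gamma$. A specification $\gamma$ is *monotonicity preserving* if $\gamma_\Lambda f$ is increasing for every finite $\Lambda$ and every increasing measurable $f$; it is *translation invariant* if $\gamma_{\tau_i\Lambda}(\cdot\,|\,\tau_i\omega)$ is the image of $\gamma_\Lambda(\cdot\,|\,\omega)$ under $\tau_i$ for all $i$, $\Lambda$, $\omega$. Let $\Lambda_n=\{\tau_{-i}(0): i\in([-n,n]\cap\mathbb Z)^d\}$. For probability measures $\mu,\nu$ on $\Omega$ let $H_\Lambda(\mu|\nu)\in[0,\infty]$ be the relative entropy (Kullback–Leibler divergence) of the projection of $\mu$ on $\Omega_0^\Lambda$ relative to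 that of $\nu$; "$h(\mu|\nu)=0$" means that $\lim_{n\to\infty}H_{\Lambda_n}(\mu|\nu)/|\Lambda_n|$ exists and equals $0$. **Statement.** Let $\gamma$ be a monotonicity-preserving, translation-invariant specification. Then the weak limits, along finite sets directed by inclusion, $$\gamma^{(\pm)}_\Lambda(\cdot\,|\,\omega)=\lim_{V\uparrow\mathbb L}\gamma_\Lambda(\cdot\,|\,\omega_V\,\pm_{V^c}),\qquad \mu^\pm=\lim_{\Lambda\uparrow\mathbb L}\gamma_\Lambda(\cdot\,|\,\pm)$$ exist, and $\gamma^{(+)}$, $\gamma^{(-)}$ are specifications. Let $\Omega_\pm$ be the set of $\omega\in\Omega$ such that $\gamma^{(+)}_\Lambda f(\omega)=\gamma^{(-)}_\Lambda f(\omega)$ for all finite $\Lambda$ and all local $f$. Then: (a) If $h(\mu^-|\mu^+)=0$, then $\mu^-\in\mathcal G(\gamma^{(+)})$ and $\mu^-(\Omega_{\gamma^{(+)}})=\mu^-(\Omega_{\gamma^{(-)}})=1$; hence $\mu^-$ is almost quasilocal. (b) If $\mu$ is a translation-invariant probability measure on $\Omega$ with $h(\mu|\mu^+)=0$ and $\mu(\Omega_\pm)=1$,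 then $\mu\in\mathcal G(\gamma^{(+)})$, and $\mu$ is almost quasilocal. The same holds with $+$ and $-$ interchanged: if $h(\mu^+|\mu^-)=0$, then $\mu^+\in\mathcal G(\gamma^{(-)})$, $\mu^+(\Omega_{\gamma^{(+)}})=\mu^+(\Omega_{\gamma^{(-)}})=1$ and $\mu^+$ is almost quasilocal; and any translation-invariant probability measure $\mu$ with $h(\mu|\mu^-)=0$ and $\mu(\Omega_\pm)=1$ is consistent with $\gamma^{(-)}$ and almost quasilocal. -/

import Mathlib

open MeasureTheory Filter Topology
open scoped ENNReal

noncomputable section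

namespace LatticeSpin

/-! The lattice is a countable set `L`, the finite single-spin space is `S`, and configurations are
the functions `L → S` with the product topology, product σ-algebra and coordinatewise order.
`cylinderEvents D` is the σ-algebra generated by the spins in `D ⊆ L`. -/

/-- A family of probability measures `γ_Λ(· | ω)`, indexed by the finite sets `Λ` and the
configurations `ω`; the requirements for it to be a specification are in `IsSpecification`. -/
abbrev KernelFamily (L S : Type*) [MeasurableSpace S] : Type _ :=
  Finset L → (L → S) → ProbabilityMeasure (L → S)

/-- Specifications: `γ_Λ(A | ·)` is measurable with respect to the spins outside `Λ`, the kernels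
are proper, and `γ_Λ' γ_Λ = γ_Λ'` at every configuration whenever `Λ ⊆ Λ'`. -/
structure IsSpecification {L S : Type*} [MeasurableSpace S] (γ : KernelFamily L S) : Prop where
  measurable : ∀ (Λ : Finset L) (A : Set (L → S)), MeasurableSet A →
    Measurable[cylinderEvents ((Λ : Set L)ᶜ)] fun ω => (γ Λ ω : Measure (L → S)) A
  proper : ∀ (Λ : Finset L) (B : Set (L → S)),
    MeasurableSet[cylinderEvents ((Λ : Set L)ᶜ)] B →
      ∀ ω, (γ Λ ω : Measure (L → S)) B = B.indicator (fun _ => (1 : ℝ≥0∞)) ω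
  consistent : ∀ Λ Λ' : Finset L, Λ ⊆ Λ' → ∀ (ω : L → S) (A : Set (L → S)), MeasurableSet A →
    ∫⁻ ω', (γ Λ ω' : Measure (L → S)) A ∂(γ Λ' ω : Measure (L → S))
      = (γ Λ' ω : Measure (L → S)) A

/-- The DLR equations `μ γ_Λ = μ`: for a specification `γ` they say `μ ∈ 𝒢(γ)`. -/
def IsConsistentWith {L S : Type*} [MeasurableSpace S] (μ : ProbabilityMeasure (L → S))
    (γ : KernelFamily L S) : Prop :=
  ∀ (Λ : Finset L) (A : Set (L → S)), MeasurableSet A →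
    ∫⁻ ω, (γ Λ ω : Measure (L → S)) A ∂(μ : Measure (L → S)) = (μ : Measure (L → S)) A

/-- Local functions: those that depend on finitely many spins. -/
def IsLocal {L S : Type*} (f : (L → S) → ℝ) : Prop :=
  ∃ Δ : Finset L, DependsOn f (Δ : Set L)

/-- The function `γ_Λ f`. -/
def kernelApply {L S : Type*} [MeasurableSpace S] (γ : KernelFamily L S) (Λ : Finset L)
    (f : (L → S) → ℝ) (ω : L → S) : ℝ :=
  ∫ σ, f σ ∂(γ Λ ω : Measure (L → S))

/-- The set `Ω_γ` of configurations at which `γ_Λ f` is continuous for all finite `Λ` and all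
local `f`. -/
def continuitySet {L S : Type*} [MeasurableSpace S] [TopologicalSpace S]
    (γ : KernelFamily L S) : Set (L → S) :=
  {ω | ∀ (Λ : Finset L) (f : (L → S) → ℝ), IsLocal f → ContinuousAt (kernelApply γ Λ f) ω}

/-- Almost quasilocal measures. -/
def IsAlmostQuasilocal {L S : Type*} [MeasurableSpace S] [TopologicalSpace S]
    (μ : ProbabilityMeasure (L → S)) : Prop :=
  ∃ γ : KernelFamily L S, IsSpecification γ ∧ IsConsistentWith μ γ ∧
    (μ : Measure (L → S)) (continuitySet γ) = 1

/-- `γ_Λ f` is increasing whenever the (measurable) function `f` is. An increasing function lies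
between its values at the minimal and the maximal configuration, hence is bounded. -/
def IsMonotonicityPreserving {L S : Type*} [MeasurableSpace S] [LinearOrder S]
    (γ : KernelFamily L S) : Prop :=
  ∀ (Λ : Finset L) (f : (L → S) → ℝ), Measurable f → Monotone f → Monotone (kernelApply γ Λ f)

/-! ### Translations -/

/-- The translate `(τ_i ω)_x = ω_{τ_{-i} x}`. -/
def translateConfig {L S G : Type*} [AddGroup G] [AddAction G L] (i : G) (ω : L → S) : L → S :=
  fun x => ω (-i +ᵥ x)

/-- Translation invariance of a measure. -/
def IsInvariantMeasure {L S : Type*} [MeasurableSpace S] (d : ℕ) [AddAction (Fin d → ℤ) L]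
    (μ : ProbabilityMeasure (L → S)) : Prop :=
  ∀ i : Fin d → ℤ, (μ : Measure (L → S)).map (translateConfig i) = (μ : Measure (L → S))

/-- Translation invariance of a specification: `γ_{τ_i Λ}(· | τ_i ω)` is the image of
`γ_Λ(· | ω)` under `τ_i`. -/
def IsInvariantFamily {L S : Type*} [MeasurableSpace S] (d : ℕ) [AddAction (Fin d → ℤ) L]
    (γ : KernelFamily L S) : Prop :=
  ∀ (i : Fin d → ℤ) (Λ : Finset L) (ω : L → S),
    (γ (Λ.map (AddAction.toPerm i).toEmbedding) (translateConfig i ω) : Measure (L → S))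
      = (γ Λ ω : Measure (L → S)).map (translateConfig i)

/-! ### Relative entropy density -/

open Classical in
/-- The cube `Λ_n = {τ_{-i} o : i ∈ [-n, n]^d}` around the base point `o`. -/
def cube {L : Type*} (d : ℕ) [AddAction (Fin d → ℤ) L] (o : L) (n : ℕ) : Finset L :=
  (Finset.Icc (fun _ : Fin d => -(n : ℤ)) (fun _ => (n : ℤ))).image
    fun i : Fin d → ℤ => -i +ᵥ o

/-- The relative entropy `H_Λ(μ | ν)` of the projections on the spins in `Λ`
(`∞` if the projection of `μ` is not absolutely continuous). -/
def relEntropy {L S : Type*} [MeasurableSpace S] (Λ : Finset L)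
    (μ ν : ProbabilityMeasure (L → S)) : ℝ≥0∞ :=
  InformationTheory.klDiv ((μ : Measure (L → S)).map Λ.restrict)
    ((ν : Measure (L → S)).map Λ.restrict)

/-- The relative entropy density `h(μ | ν) = lim H_{Λ_n}(μ | ν) / |Λ_n|` exists and equals `h`. -/
def HasRelEntropyDensity {L S : Type*} [MeasurableSpace S] (d : ℕ) [AddAction (Fin d → ℤ) L]
    (o : L) (μ ν : ProbabilityMeasure (L → S)) (h : ℝ≥0∞) : Prop :=
  Tendsto (fun n : ℕ => relEntropy (cube d o n) μ ν / ((cube d o n).card : ℝ≥0∞)) atTop (𝓝 h)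

/-! ### Limits in a fixed direction -/

open Classical in
/-- The configuration `ω_Λ θ_{Λᶜ}`. -/
def glue {L S : Type*} (Λ : Finset L) (ω θ : L → S) : L → S :=
  fun x => if x ∈ Λ then ω x else θ x

/-- The family `lim_V γ_Λ(· | ω_V θ_{Vᶜ})`, the limit being the weak one along the finite sets `V`
directed by inclusion. For `θ = +` and `θ = -` this is `γ^{(+)}` and `γ^{(-)}`. -/
def directionLimit {L S : Type*} [Countable L] [Finite S] [MeasurableSpace S] [TopologicalSpace S]
    [BorelSpace S] (γ : KernelFamily L S) (θ : L → S) : KernelFamily L S :=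
  fun Λ ω =>
    haveI : Nonempty (ProbabilityMeasure (L → S)) := ⟨γ Λ ω⟩
    limUnder atTop fun V : Finset L => γ Λ (glue V ω θ)

/-- The measure `lim_Λ γ_Λ(· | θ)` (weak limit along the finite sets directed by inclusion).
For `θ = +` and `θ = -` this is `μ^+` and `μ^-`. -/
def boundaryLimit {L S : Type*} [Countable L] [Finite S] [MeasurableSpace S] [TopologicalSpace S]
    [BorelSpace S] (γ : KernelFamily L S) (θ : L → S) : ProbabilityMeasure (L → S) :=
  haveI : Nonempty (ProbabilityMeasure (L → S)) := ⟨γ ∅ θ⟩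
  limUnder atTop fun Λ : Finset L => γ Λ θ

/-- The limits that define `directionLimit γ θ` and `boundaryLimit γ θ` exist, and the first is
again a specification. -/
def LimitsExist {L S : Type*} [Countable L] [Finite S] [MeasurableSpace S] [TopologicalSpace S]
    [BorelSpace S] (γ : KernelFamily L S) (θ : L → S) : Prop :=
  (∀ (Λ : Finset L) (ω : L → S),
    Tendsto (fun V : Finset L => γ Λ (glue V ω θ)) atTop (𝓝 (directionLimit γ θ Λ ω))) ∧
  IsSpecification (directionLimit γ θ) ∧
  Tendsto (fun Λ : Finset L => γ Λ θ) atTop (𝓝 (boundaryLimit γ θ))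

/-- The set of configurations at which two families agree on all local functions; for `γ^{(+)}`
and `γ^{(-)}` this is `Ω_±`. -/
def agreementSet {L S : Type*} [MeasurableSpace S] (γ γ' : KernelFamily L S) : Set (L → S) :=
  {ω | ∀ (Λ : Finset L) (f : (L → S) → ℝ), IsLocal f → kernelApply γ Λ f ω = kernelApply γ' Λ f ω}

end LatticeSpin

end

/-! Write ν = μ^+ and ρ_U for the density of μ with respect to ν on the spins in U (`spinDensity`).
Two mechanisms carry the proof: zero entropy density makes μ nearly inherit the conditional
distributions of ν, and monotonicity replaces the continuity of kernels that the classical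
variational principle needs.

Entropy. The increment H_V - H_{V∖Λ} is the entropy of Λ conditional on the rest of V. Were it at
least ε for all V containing some window, disjoint translates of that window in Λ_n would contribute
ε each; they can be packed with positive density, so H would grow like the volume
(`card_mul_le_spinEntropy`, `exists_packing`). Hence some large V has a small increment, and a
Hellinger estimate makes ρ_V and ρ_U close in L¹(ν), where U = V∖Λ. Therefore μ(f) ≈ ν(ρ_U f) =
ν(ρ_U γ^{(+)}_Λ f) by the DLR equations of ν (`HasRelEntropyDensity.exists_abs_integral_sub_le`). If
γ^{(+)}_Λ f were local, the right side would be μ(γ^{(+)}_Λ f) for U large.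

Monotonicity. For increasing local f, γ^{(+)}_Λ f lies between γ_Λ f(ω_W -) and γ_Λ f(ω_W +). These
are local, so ν(ρ_U ·) = μ(·) on them once U contains W∖Λ; letting W grow, μ(γ^{(-)}_Λ f) ≤ μ(f) ≤
μ(γ^{(+)}_Λ f). If μ(Ω_±) = 1 the two ends coincide, which is the DLR equation; the same squeeze
makes both kernels continuous on Ω_±. This is (b).

For (a) it remains to prove μ^-(Ω_±) = 1. Conditionally on the spins in U, μ^- is dominated by μ^+,
so μ^-(g) ≤ μ^+(ρ_U g) for increasing local g. Thus μ^-(γ^{(+)}_Λ f) ≤ μ^+(ρ_U γ^{(+)}_Λ f) ≈ μ^-(f)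
= μ^-(γ^{(-)}_Λ f), and since γ^{(-)}_Λ f ≤ γ^{(+)}_Λ f the two agree almost surely. Signs are
interchanged by reversing the order of the spins. -/

namespace LatticeSpin

/-! ### Local functions -/

section LocalFunctions

variable {L S : Type*}

theorem _root_.DependsOn.add {f g : (L → S) → ℝ} {D : Set L} (hf : DependsOn f D)
    (hg : DependsOn g D) : DependsOn (fun σ => f σ + g σ) D :=
  fun x y h => by simp only [hf h, hg h]

theorem _root_.DependsOn.mul {f g : (L → S) → ℝ} {D : Set L} (hf : DependsOn f D)
    (hg : DependsOn g D) : DependsOn (fun σ => f σ * g σ) D :=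
  fun x y h => by simp only [hf h, hg h]

theorem _root_.DependsOn.comp_left {α : Type*} {f : (L → S) → α} {D : Set L} (hf : DependsOn f D)
    {β : Type*} (φ : α → β) : DependsOn (fun σ => φ (f σ)) D :=
  fun _ _ h => congrArg φ (hf h)

theorem exists_comp_restrict {α : Type*} [Nonempty α] {f : (L → S) → α} {Δ : Finset L}
    (hf : DependsOn f (Δ : Set L)) : ∃ g : (Δ → S) → α, f = g ∘ Δ.restrict := by
  obtain ⟨g, hg⟩ := dependsOn_iff_exists_comp.1 hf
  exact ⟨g, hg⟩

theorem IsLocal.comp_left {f : (L → S) → ℝ} (hf : IsLocal f) (φ : ℝ → ℝ) :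
    IsLocal fun σ => φ (f σ) := by
  obtain ⟨Δ, hΔ⟩ := hf
  exact ⟨Δ, hΔ.comp_left φ⟩

theorem IsLocal.add {f g : (L → S) → ℝ} (hf : IsLocal f) (hg : IsLocal g) :
    IsLocal fun σ => f σ + g σ := by
  classical
  obtain ⟨Δ, hΔ⟩ := hf
  obtain ⟨Δ', hΔ'⟩ := hg
  exact ⟨Δ ∪ Δ', (hΔ.mono (by simp)).add (hΔ'.mono (by simp))⟩

theorem IsLocal.mul {f g : (L → S) → ℝ} (hf : IsLocal f) (hg : IsLocal g) :
    IsLocal fun σ => f σ * g σ := by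
  classical
  obtain ⟨Δ, hΔ⟩ := hf
  obtain ⟨Δ', hΔ'⟩ := hg
  exact ⟨Δ ∪ Δ', (hΔ.mono (by simp)).mul (hΔ'.mono (by simp))⟩

theorem isLocal_indicator_cylinder (Δ : Finset L) (A : Set (Δ → S)) :
    IsLocal ((cylinder (α := fun _ => S) Δ A).indicator fun _ => (1 : ℝ)) := by
  classical
  refine ⟨Δ, fun x y h => ?_⟩
  have : (Δ.restrict x : Δ → S) = Δ.restrict y := funext fun z => h z z.2
  simp only [Set.indicator, mem_cylinder, this]

theorem IsLocal.continuous [TopologicalSpace S] [DiscreteTopology S] {f : (L → S) → ℝ}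
    (hf : IsLocal f) : Continuous f := by
  obtain ⟨Δ, hΔ⟩ := hf
  obtain ⟨g, rfl⟩ := exists_comp_restrict hΔ
  exact continuous_of_discreteTopology.comp (Finset.continuous_restrict Δ)

variable [Finite S]

theorem IsLocal.exists_bound {f : (L → S) → ℝ} (hf : IsLocal f) : ∃ M, 0 < M ∧ ∀ σ, |f σ| ≤ M := by
  obtain ⟨Δ, hΔ⟩ := hf
  obtain ⟨g, rfl⟩ := exists_comp_restrict hΔ
  obtain ⟨M, hM⟩ := (Set.finite_range fun x => |g x|).bddAbove
  refine ⟨max M 1, by positivity, fun σ => le_max_of_le_left (hM ⟨_, rfl⟩)⟩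

variable [MeasurableSpace S] [MeasurableSingletonClass S]

theorem _root_.DependsOn.measurable_cylinderEvents {f : (L → S) → ℝ} {Δ : Finset L} {D : Set L}
    (hf : DependsOn f (Δ : Set L)) (hD : (Δ : Set L) ⊆ D) : Measurable[cylinderEvents D] f := by
  obtain ⟨g, rfl⟩ := exists_comp_restrict hf
  have hg : Measurable g := measurable_of_finite g
  have h : @Measurable _ _ (cylinderEvents D) _ (Δ.restrict : (L → S) → _) :=
    @measurable_pi_lambda _ _ _ (cylinderEvents D) _ _
      fun x => measurable_cylinderEvent_apply (hD x.2)
  exact @Measurable.comp _ _ _ (cylinderEvents D) _ _ _ _ hg h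

theorem IsLocal.measurable {f : (L → S) → ℝ} (hf : IsLocal f) : Measurable f := by
  obtain ⟨Δ, hΔ⟩ := hf
  exact (hΔ.measurable_cylinderEvents (Set.subset_univ _)).mono (by simp) le_rfl

theorem integrable_of_abs_le {Ω : Type*} [MeasurableSpace Ω] {f : Ω → ℝ} (hf : Measurable f) {M : ℝ}
    (hM : ∀ σ, |f σ| ≤ M) (P : Measure Ω) [IsFiniteMeasure P] : Integrable f P :=
  Integrable.of_bound hf.aestronglyMeasurable M (Eventually.of_forall hM)

theorem IsLocal.integrable {f : (L → S) → ℝ} (hf : IsLocal f) (P : Measure (L → S))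
    [IsFiniteMeasure P] : Integrable f P := by
  obtain ⟨M, -, hM⟩ := hf.exists_bound
  exact integrable_of_abs_le hf.measurable hM P

end LocalFunctions

theorem tendsto_integral_of_tendsto {L S : Type*} [Finite S] [Countable L]
    [MeasurableSpace S] [TopologicalSpace S] [DiscreteTopology S]
    [BorelSpace S] {ι : Type*} {l : Filter ι}
    {P : ι → ProbabilityMeasure (L → S)} {Q : ProbabilityMeasure (L → S)}
    (h : Tendsto P l (𝓝 Q)) {f : (L → S) → ℝ} (hf : IsLocal f) :
    Tendsto (fun i => ∫ σ, f σ ∂(P i : Measure (L → S))) l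
      (𝓝 (∫ σ, f σ ∂(Q : Measure (L → S)))) := by
  obtain ⟨M, -, hM⟩ := hf.exists_bound
  exact ProbabilityMeasure.tendsto_iff_forall_integral_tendsto.1 h
    (BoundedContinuousFunction.ofNormedAddCommGroup f hf.continuous M hM)

/-! ### Increasing local functions determine measures and weak limits -/

section Order

variable {L S : Type*} [Finite S] [LinearOrder S]

theorem exists_strictMono_nat (S : Type*) [Finite S] [LinearOrder S] :
    ∃ r : S → ℕ, StrictMono r :=
  ⟨fun s => (Set.Iio s).ncard, fun _ _ h => Set.ncard_lt_ncard (Set.Iio_ssubset_Iio h)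
    (Set.toFinite _)⟩

/-- Every local function is a difference of two increasing local functions. -/
theorem IsLocal.exists_monotone_sub {f : (L → S) → ℝ} (hf : IsLocal f) :
    ∃ g h : (L → S) → ℝ, IsLocal g ∧ IsLocal h ∧ Monotone g ∧ Monotone h ∧
      f = fun σ => g σ - h σ := by
  obtain ⟨r, hr⟩ := exists_strictMono_nat S
  obtain ⟨M, hM0, hM⟩ := hf.exists_bound
  obtain ⟨Δ, hΔ⟩ := hf
  -- If σ ≤ τ differ on Δ, the rank sum rises by at least 1, so `k` rises by at least 2M, the
  -- largest possible drop of f.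
  let k : (L → S) → ℝ := fun σ => 2 * M * ∑ x ∈ Δ, (r (σ x) : ℝ)
  have hk : DependsOn k (Δ : Set L) := fun σ τ h => by
    simp only [k]
    congr 1
    exact Finset.sum_congr rfl fun x hx => by rw [h x hx]
  have hkm : Monotone k := fun σ τ h => by
    simp only [k]
    gcongr with x hx
    exact hr.monotone (h x)
  refine ⟨fun σ => f σ + k σ, k, ⟨Δ, hΔ.add hk⟩, ⟨Δ, hk⟩, fun σ τ h => ?_, hkm, ?_⟩
  · by_cases hE : ∀ x ∈ Δ, σ x = τ x
    · have h1 : f σ = f τ := hΔ hE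
      have h2 : k σ = k τ := hk hE
      simp only [h1, h2, le_refl]
    · push Not at hE
      obtain ⟨x, hx, hne⟩ := hE
      have hlt : ∑ x ∈ Δ, r (σ x) < ∑ x ∈ Δ, r (τ x) :=
        Finset.sum_lt_sum (fun y _ => hr.monotone (h y)) ⟨x, hx, hr (lt_of_le_of_ne (h x) hne)⟩
      have hlt' : (∑ x ∈ Δ, (r (σ x) : ℝ)) + 1 ≤ ∑ x ∈ Δ, (r (τ x) : ℝ) := by
        exact_mod_cast hlt
      have h1 := abs_le.1 (hM σ)
      have h2 := abs_le.1 (hM τ)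
      have h3 := mul_le_mul_of_nonneg_left hlt' (by positivity : 0 ≤ 2 * M)
      simp only [k]
      linarith
  · funext σ
    ring

variable [MeasurableSpace S] [MeasurableSingletonClass S]

theorem integral_eq_of_monotone_local {P Q : ProbabilityMeasure (L → S)}
    (h : ∀ f : (L → S) → ℝ, IsLocal f → Monotone f →
      ∫ σ, f σ ∂(P : Measure (L → S)) = ∫ σ, f σ ∂(Q : Measure (L → S)))
    {f : (L → S) → ℝ} (hf : IsLocal f) :
    ∫ σ, f σ ∂(P : Measure (L → S)) = ∫ σ, f σ ∂(Q : Measure (L → S)) := by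
  obtain ⟨a, b, ha, hb, hma, hmb, rfl⟩ := hf.exists_monotone_sub
  rw [integral_sub (ha.integrable _) (hb.integrable _), h a ha hma, h b hb hmb,
    integral_sub (ha.integrable _) (hb.integrable _)]

theorem measure_eq_of_monotone_local {P Q : ProbabilityMeasure (L → S)}
    (h : ∀ f : (L → S) → ℝ, IsLocal f → Monotone f →
      ∫ σ, f σ ∂(P : Measure (L → S)) = ∫ σ, f σ ∂(Q : Measure (L → S))) : P = Q := by
  apply ProbabilityMeasure.toMeasure_injective
  refine ext_of_generate_finite _ generateFrom_measurableCylinders.symm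
    isPiSystem_measurableCylinders (fun s hs => ?_) (by simp)
  obtain ⟨Δ, A, hA, rfl⟩ := (mem_measurableCylinders _).1 hs
  have h1 := integral_eq_of_monotone_local h (isLocal_indicator_cylinder Δ A)
  have hm : MeasurableSet (cylinder (α := fun _ => S) Δ A) := hA.cylinder _
  rw [integral_indicator_const _ hm, integral_indicator_const _ hm] at h1
  simp only [smul_eq_mul, mul_one] at h1
  exact (ENNReal.toReal_eq_toReal_iff' (measure_ne_top _ _) (measure_ne_top _ _)).1 h1

variable [TopologicalSpace S] [DiscreteTopology S] [BorelSpace S] [Countable L]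

/-- Weak convergence follows from the convergence of the integrals of increasing local
functions. -/
theorem exists_tendsto_of_monotone_local {ι : Type*} {l : Filter ι} [l.NeBot]
    {P : ι → ProbabilityMeasure (L → S)}
    (h : ∀ f : (L → S) → ℝ, IsLocal f → Monotone f →
      ∃ c, Tendsto (fun i => ∫ σ, f σ ∂(P i : Measure (L → S))) l (𝓝 c)) :
    ∃ Q, Tendsto P l (𝓝 Q) := by
  -- The configuration space is compact, hence so is the space of probability measures. Limits along
  -- ultrafilters exist, and they all coincide because they agree on increasing local functions.
  have key : ∀ u : Ultrafilter ι, ∃ Q, Tendsto P u (𝓝 Q) := fun u => by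
    obtain ⟨Q, -, hQ⟩ := isCompact_univ.ultrafilter_le_nhds (u.map P) (by simp)
    exact ⟨Q, hQ⟩
  obtain ⟨Q, hQ⟩ := key (Ultrafilter.of l)
  refine ⟨Q, tendsto_iff_ultrafilter _ _ _ |>.2 fun u hu => ?_⟩
  obtain ⟨R, hR⟩ := key u
  suffices Q = R by rwa [this]
  refine measure_eq_of_monotone_local fun f hf hm => ?_
  obtain ⟨c, hc⟩ := h f hf hm
  exact (tendsto_nhds_unique (tendsto_integral_of_tendsto hQ hf)
    (hc.mono_left (Ultrafilter.of_le l))).trans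
    (tendsto_nhds_unique (tendsto_integral_of_tendsto hR hf) (hc.mono_left hu)).symm

end Order

/-! ### Calculus of specifications and DLR equations -/

section Kernels

theorem integral_bind_of_bounded {α β : Type*} {mα : MeasurableSpace α} {mβ : MeasurableSpace β}
    {P : Measure α} [IsProbabilityMeasure P] {κ : α → Measure β}
    [∀ a, IsProbabilityMeasure (κ a)] (hκ : Measurable κ) {f : β → ℝ} (hf : Measurable f) {M : ℝ}
    (hM : ∀ σ, |f σ| ≤ M) :
    ∫ b, f b ∂(P.bind κ) = ∫ a, ∫ b, f b ∂(κ a) ∂P := by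
  let K : ProbabilityTheory.Kernel α β := ⟨κ, hκ⟩
  have : ProbabilityTheory.IsMarkovKernel K := ⟨fun a => inferInstanceAs (IsProbabilityMeasure (κ a))⟩
  have h : P.bind κ = ProbabilityTheory.Kernel.comp K (ProbabilityTheory.Kernel.const Unit P) () :=
    Measure.comp_eq_comp_const_apply (κ := K) (μ := P)
  rw [h, ProbabilityTheory.Kernel.integral_comp (integrable_of_abs_le hf hM _)]
  rfl

/-- Every event of `cylinderEvents D` is a preimage under restriction to D. The level set of f
through σ is such an event, so it contains every τ that agrees with σ on D. -/
theorem dependsOn_of_measurable_cylinderEvents {L S : Type*} [MeasurableSpace S] {f : (L → S) → ℝ}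
    {D : Set L} (hf : Measurable[cylinderEvents D] f) : DependsOn f D := by
  have hle : cylinderEvents (X := fun _ : L => S) D ≤
      MeasurableSpace.comap (D.domRestrict (π := fun _ => S)) MeasurableSpace.pi := by
    refine iSup₂_le fun x hx => ?_
    rintro _ ⟨A, hA, rfl⟩
    exact ⟨(fun σ : D → S => σ ⟨x, hx⟩) ⁻¹' A, measurable_pi_apply _ hA, rfl⟩
  intro σ τ h
  obtain ⟨A, -, hA⟩ := hle _ (hf (measurableSet_singleton (f σ)))
  have hr : D.domRestrict σ = D.domRestrict τ := funext fun x => h x x.2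
  have h1 : σ ∈ D.domRestrict ⁻¹' A := by rw [hA]; exact rfl
  have h2 : τ ∈ D.domRestrict ⁻¹' A := by
    rw [Set.mem_preimage, ← hr]
    exact h1
  rw [hA] at h2
  exact (Set.mem_singleton_iff.1 h2).symm

theorem dependsOn_indicator_of_measurableSet_cylinderEvents {L S : Type*} [MeasurableSpace S]
    {B : Set (L → S)} {D : Set L} (hB : MeasurableSet[cylinderEvents D] B) :
    DependsOn (B.indicator fun _ => (1 : ℝ)) D := by
  have h : Measurable[cylinderEvents D] fun _ : L → S => (1 : ℝ) := measurable_const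
  exact dependsOn_of_measurable_cylinderEvents (h.indicator hB)

variable {L S : Type*} [MeasurableSpace S] {γ : KernelFamily L S}

theorem IsSpecification.measurable_family (h : IsSpecification γ) (Λ : Finset L) :
    Measurable[cylinderEvents ((Λ : Set L)ᶜ)] fun ω => (γ Λ ω : Measure (L → S)) :=
  @Measure.measurable_of_measurable_coe _ _ _ (cylinderEvents ((Λ : Set L)ᶜ)) _
    fun A hA => h.measurable Λ A hA

theorem IsSpecification.measurable_family' (h : IsSpecification γ) (Λ : Finset L) :
    Measurable fun ω => (γ Λ ω : Measure (L → S)) :=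
  (h.measurable_family Λ).mono cylinderEvents_le_pi le_rfl

theorem IsSpecification.measurable_kernelApply (h : IsSpecification γ) (Λ : Finset L)
    {f : (L → S) → ℝ} (hf : Measurable f) :
    Measurable[cylinderEvents ((Λ : Set L)ᶜ)] (kernelApply γ Λ f) :=
  (StronglyMeasurable.integral_kernel
    (κ := @ProbabilityTheory.Kernel.mk _ _ (cylinderEvents ((Λ : Set L)ᶜ)) _ _
      (h.measurable_family Λ)) hf.stronglyMeasurable).measurable

theorem IsSpecification.measurable_kernelApply' (h : IsSpecification γ) (Λ : Finset L)
    {f : (L → S) → ℝ} (hf : Measurable f) : Measurable (kernelApply γ Λ f) :=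
  (h.measurable_kernelApply Λ hf).mono cylinderEvents_le_pi le_rfl

theorem IsSpecification.dependsOn_kernelApply (h : IsSpecification γ) (Λ : Finset L)
    {f : (L → S) → ℝ} (hf : Measurable f) :
    DependsOn (kernelApply γ Λ f) ((Λ : Set L)ᶜ) :=
  dependsOn_of_measurable_cylinderEvents (h.measurable_kernelApply Λ hf)

theorem abs_kernelApply_le {f : (L → S) → ℝ} {M : ℝ} (hM : ∀ σ, |f σ| ≤ M) (Λ : Finset L)
    (ω : L → S) : |kernelApply γ Λ f ω| ≤ M := by
  have := norm_integral_le_of_norm_le_const (μ := (γ Λ ω : Measure (L → S))) (f := f) (C := M)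
    (Eventually.of_forall hM)
  simpa [kernelApply] using this

theorem IsSpecification.bind_eq (h : IsSpecification γ) {Λ Λ' : Finset L} (hΛ : Λ ⊆ Λ')
    (ω : L → S) : (γ Λ' ω : Measure (L → S)).bind (fun ω' => (γ Λ ω' : Measure (L → S))) =
      (γ Λ' ω : Measure (L → S)) := by
  refine Measure.ext fun A hA => ?_
  rw [Measure.bind_apply hA (h.measurable_family' Λ).aemeasurable]
  exact h.consistent Λ Λ' hΛ ω A hA

theorem IsSpecification.kernelApply_kernelApply (h : IsSpecification γ) {Λ Λ' : Finset L}
    (hΛ : Λ ⊆ Λ') {f : (L → S) → ℝ} (hf : Measurable f) {M : ℝ} (hM : ∀ σ, |f σ| ≤ M)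
    (ω : L → S) : kernelApply γ Λ' (kernelApply γ Λ f) ω = kernelApply γ Λ' f ω := by
  unfold kernelApply
  rw [← integral_bind_of_bounded (h.measurable_family' Λ) hf hM, h.bind_eq hΛ]

theorem IsSpecification.ae_eq_apply [MeasurableSingletonClass S] (h : IsSpecification γ)
    {Λ : Finset L} {x : L} (hx : x ∉ Λ) (ω : L → S) :
    ∀ᵐ σ ∂(γ Λ ω : Measure (L → S)), σ x = ω x := by
  have hB : MeasurableSet[cylinderEvents ((Λ : Set L)ᶜ)] {σ : L → S | σ x = ω x} :=
    (measurable_cylinderEvent_apply (X := fun _ => S) (by simpa using hx :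
      x ∈ ((Λ : Set L)ᶜ))) (measurableSet_singleton (ω x))
  have h1 := h.proper Λ _ hB ω
  rw [Set.indicator_of_mem (by simp)] at h1
  exact (prob_compl_eq_zero_iff (cylinderEvents_le_pi _ hB)).2 h1

theorem IsSpecification.ae_eqOn [MeasurableSingletonClass S] [Countable L]
    (h : IsSpecification γ) (Λ : Finset L) (ω : L → S) :
    ∀ᵐ σ ∂(γ Λ ω : Measure (L → S)), ∀ x ∉ Λ, σ x = ω x := by
  rw [ae_all_iff]
  intro x
  by_cases hx : x ∈ Λ
  · simp [hx]
  · filter_upwards [h.ae_eq_apply hx ω] with σ hσ _ using hσ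

theorem IsSpecification.kernelApply_congr [MeasurableSingletonClass S] [Countable L]
    (h : IsSpecification γ) {Λ : Finset L} {ω : L → S} {f g : (L → S) → ℝ}
    (hfg : ∀ σ, (∀ x ∉ Λ, σ x = ω x) → f σ = g σ) :
    kernelApply γ Λ f ω = kernelApply γ Λ g ω :=
  integral_congr_ae (by filter_upwards [h.ae_eqOn Λ ω] with σ hσ using hfg σ hσ)

/-- Properness freezes the spins outside Λ almost surely, and g sees only those, so g is almost
surely the constant g(ω). -/
theorem IsSpecification.kernelApply_mul [MeasurableSingletonClass S] [Countable L]
    (h : IsSpecification γ) {Λ : Finset L} (ω : L → S) {g : (L → S) → ℝ}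
    (hg : DependsOn g ((Λ : Set L)ᶜ)) (f : (L → S) → ℝ) :
    kernelApply γ Λ (fun σ => g σ * f σ) ω = g ω * kernelApply γ Λ f ω := by
  rw [h.kernelApply_congr (g := fun σ => g ω * f σ)
    fun σ hσ => by rw [hg fun x hx => hσ x (by simpa using hx)]]
  exact integral_const_mul _ _

theorem IsConsistentWith.integral_kernelApply {μ : ProbabilityMeasure (L → S)}
    (h : IsSpecification γ) (hμ : IsConsistentWith μ γ) (Λ : Finset L) {f : (L → S) → ℝ}
    (hf : Measurable f) {M : ℝ} (hM : ∀ σ, |f σ| ≤ M) :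
    ∫ σ, kernelApply γ Λ f σ ∂(μ : Measure (L → S)) = ∫ σ, f σ ∂(μ : Measure (L → S)) := by
  unfold kernelApply
  rw [← integral_bind_of_bounded (h.measurable_family' Λ) hf hM]
  congr 1
  refine Measure.ext fun A hA => ?_
  rw [Measure.bind_apply hA (h.measurable_family' Λ).aemeasurable]
  exact hμ Λ A hA

variable [Finite S] [LinearOrder S] [MeasurableSingletonClass S]

/-- The DLR equations may be tested on increasing local functions. -/
theorem lintegral_eq_of_monotone_local {κ : (L → S) → ProbabilityMeasure (L → S)}
    (hκ : Measurable fun ω => (κ ω : Measure (L → S))) {P Q : ProbabilityMeasure (L → S)}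
    (h : ∀ f : (L → S) → ℝ, IsLocal f → Monotone f →
      ∫ ω, ∫ σ, f σ ∂(κ ω : Measure (L → S)) ∂(P : Measure (L → S)) =
        ∫ σ, f σ ∂(Q : Measure (L → S))) {A : Set (L → S)} (hA : MeasurableSet A) :
    ∫⁻ ω, (κ ω : Measure (L → S)) A ∂(P : Measure (L → S)) = (Q : Measure (L → S)) A := by
  have hp : IsProbabilityMeasure
      ((P : Measure (L → S)).bind fun ω => (κ ω : Measure (L → S))) :=
    isProbabilityMeasure_bind hκ.aemeasurable (Eventually.of_forall fun ω => inferInstance)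
  have : (⟨_, hp⟩ : ProbabilityMeasure (L → S)) = Q := by
    refine measure_eq_of_monotone_local fun f hf hm => ?_
    obtain ⟨M, -, hM⟩ := hf.exists_bound
    rw [← h f hf hm]
    exact integral_bind_of_bounded hκ hf.measurable hM
  rw [← this, ← Measure.bind_apply hA hκ.aemeasurable]
  rfl

theorem isConsistentWith_of_monotone_local (h : IsSpecification γ) {μ : ProbabilityMeasure (L → S)}
    (H : ∀ (Λ : Finset L) (f : (L → S) → ℝ), IsLocal f → Monotone f →
      ∫ ω, kernelApply γ Λ f ω ∂(μ : Measure (L → S)) = ∫ σ, f σ ∂(μ : Measure (L → S))) :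
    IsConsistentWith μ γ :=
  fun Λ _ hA => lintegral_eq_of_monotone_local (h.measurable_family' Λ) (H Λ) hA

/-- Each axiom survives weak limits only in its local form, which is what is assumed here. Cylinders
form a generating π-system, so measurability extends to all events; properness may be checked site
by site since L is countable; consistency is an equality of measures, tested on increasing local
functions. -/
theorem isSpecification_of_local [Countable L]
    (h1 : ∀ (Λ : Finset L) (f : (L → S) → ℝ), IsLocal f →
      Measurable[cylinderEvents ((Λ : Set L)ᶜ)] (kernelApply γ Λ f))
    (h2 : ∀ (Λ : Finset L) (ω : L → S), ∀ x ∉ Λ,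
      ∀ᵐ σ ∂(γ Λ ω : Measure (L → S)), σ x = ω x)
    (h3 : ∀ Λ Λ' : Finset L, Λ ⊆ Λ' → ∀ (ω : L → S) (f : (L → S) → ℝ), IsLocal f → Monotone f →
      kernelApply γ Λ' (kernelApply γ Λ f) ω = kernelApply γ Λ' f ω) :
    IsSpecification γ := by
  have hm : ∀ Λ : Finset L,
      Measurable[cylinderEvents ((Λ : Set L)ᶜ)] fun ω => (γ Λ ω : Measure (L → S)) := by
    intro Λ
    refine @Measurable.measure_of_isPiSystem_of_isProbabilityMeasure _ _
      (cylinderEvents ((Λ : Set L)ᶜ)) _ _ _ _ generateFrom_measurableCylinders.symm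
      isPiSystem_measurableCylinders fun s hs => ?_
    obtain ⟨Δ, A, hA, rfl⟩ := (mem_measurableCylinders _).1 hs
    have hms : MeasurableSet (cylinder (α := fun _ => S) Δ A) := hA.cylinder _
    have h4 := h1 Λ _ (isLocal_indicator_cylinder Δ A)
    have h5 : (fun ω => (γ Λ ω : Measure (L → S)) (cylinder (α := fun _ => S) Δ A)) =
        fun ω => ENNReal.ofReal (kernelApply γ Λ
          ((cylinder (α := fun _ => S) Δ A).indicator fun _ => (1 : ℝ)) ω) := by
      funext ω
      simp only [kernelApply]
      rw [integral_indicator_const _ hms]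
      simp [Measure.real]
    rw [h5]
    exact @Measurable.ennreal_ofReal _ (cylinderEvents ((Λ : Set L)ᶜ)) _ h4
  have hm' : ∀ Λ : Finset L, Measurable fun ω => (γ Λ ω : Measure (L → S)) :=
    fun Λ => (hm Λ).mono cylinderEvents_le_pi le_rfl
  refine ⟨fun Λ A hA => ?_, fun Λ B hB ω => ?_, fun Λ Λ' hΛ ω A hA => ?_⟩
  · exact @Measurable.comp _ _ _ (cylinderEvents ((Λ : Set L)ᶜ)) _ _ _ _
      (Measure.measurable_coe hA) (hm Λ)
  · have hd := dependsOn_indicator_of_measurableSet_cylinderEvents hB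
    have hmem : ∀ᵐ σ ∂(γ Λ ω : Measure (L → S)), σ ∈ B ↔ ω ∈ B := by
      have : ∀ᵐ σ ∂(γ Λ ω : Measure (L → S)), ∀ x ∉ Λ, σ x = ω x := by
        rw [ae_all_iff]
        intro x
        by_cases hx : x ∈ Λ
        · simp [hx]
        · filter_upwards [h2 Λ ω x hx] with σ hσ _ using hσ
      filter_upwards [this] with σ hσ
      have := hd (x := σ) (y := ω) fun x hx => hσ x (by simpa using hx)
      by_cases h6 : σ ∈ B <;> by_cases h7 : ω ∈ B <;> simp_all
    by_cases hω : ω ∈ B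
    · rw [Set.indicator_of_mem hω, ← prob_compl_eq_zero_iff (cylinderEvents_le_pi _ hB)]
      filter_upwards [hmem] with σ hσ using hσ.2 hω
    · rw [Set.indicator_of_notMem hω]
      exact measure_eq_zero_iff_ae_notMem.2 (by filter_upwards [hmem] with σ hσ using fun h => hω (hσ.1 h))
  · exact lintegral_eq_of_monotone_local (hm' Λ) (h3 Λ Λ' hΛ ω) hA

end Kernels

/-! ### Configurations glued to a fixed boundary -/

section Glue

variable {L S : Type*}

theorem dependsOn_glue (V : Finset L) (θ : L → S) : DependsOn (fun ω => glue V ω θ) (V : Set L) := by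
  intro σ τ h
  funext x
  by_cases hx : x ∈ V
  · simpa [glue, hx] using h x hx
  · simp [glue, hx]

theorem glue_apply_of_notMem {V : Finset L} {x : L} (hx : x ∉ V) (ω θ : L → S) :
    glue V ω θ x = θ x := by simp [glue, hx]

theorem glue_apply_of_mem {V : Finset L} {x : L} (hx : x ∈ V) (ω θ : L → S) :
    glue V ω θ x = ω x := by simp [glue, hx]

theorem glue_eq_self {V : Finset L} {ω θ : L → S} (h : ∀ x ∉ V, ω x = θ x) : glue V ω θ = ω := by
  funext x
  by_cases hx : x ∈ V
  · simp [glue, hx]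
  · simp [glue, hx, h x hx]

theorem measurable_glue_cylinderEvents [MeasurableSpace S] (V : Finset L) (θ : L → S) (D : Set L) :
    @Measurable _ _ (cylinderEvents D) (cylinderEvents D) fun ω : L → S => glue V ω θ := by
  rw [measurable_cylinderEvents_iff]
  intro x hx
  by_cases hV : x ∈ V
  · simpa only [glue, hV, if_true] using measurable_cylinderEvent_apply (X := fun _ => S) hx
  · simp only [glue, hV, if_false]
    exact measurable_const

variable [LinearOrder S] {θ : L → S}

theorem antitone_glue (hθ : IsTop θ) (ω : L → S) : Antitone fun V : Finset L => glue V ω θ := by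
  intro V W h x
  by_cases hx : x ∈ V
  · simp [glue, hx, h hx]
  · simp only
    rw [glue_apply_of_notMem hx ω θ]
    exact hθ (glue W ω θ) x

theorem le_glue (hθ : IsTop θ) (V : Finset L) (ω : L → S) : ω ≤ glue V ω θ := by
  intro x
  by_cases hx : x ∈ V
  · simp [glue, hx]
  · simpa [glue, hx] using hθ _ x

theorem glue_mono (V : Finset L) (θ : L → S) : Monotone fun ω => glue V ω θ := by
  intro ω ω' h x
  by_cases hx : x ∈ V
  · simpa [glue, hx] using h x
  · simp [glue, hx]

theorem glue_mono_right (V : Finset L) (ω : L → S) : Monotone fun θ => glue V ω θ := by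
  intro θ θ' h x
  by_cases hx : x ∈ V
  · simp [glue, hx]
  · simpa [glue, hx] using h x

end Glue

/-! ### Kernels with glued boundary conditions -/

section GluedBoundary

theorem bddBelow_range_of_abs_le {ι : Type*} {a : ι → ℝ} {M : ℝ} (h : ∀ i, |a i| ≤ M) :
    BddBelow (Set.range a) :=
  ⟨-M, by rintro _ ⟨i, rfl⟩; exact (abs_le.1 (h i)).1⟩

variable {L S : Type*} [MeasurableSpace S] {γ : KernelFamily L S} {θ : L → S}

theorem isLocal_kernelApply_glue (γ : KernelFamily L S) (θ : L → S) (Λ V : Finset L)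
    (f : (L → S) → ℝ) : IsLocal fun ω => kernelApply γ Λ f (glue V ω θ) :=
  ⟨V, (dependsOn_glue V θ).comp_left _⟩

theorem IsSpecification.dependsOn_kernelApply_glue (hγ : IsSpecification γ) (θ : L → S)
    (Λ V : Finset L) {f : (L → S) → ℝ} (hf : Measurable f) :
    DependsOn (fun ω => kernelApply γ Λ f (glue V ω θ)) ((V : Set L) \ Λ) := by
  intro σ τ h
  refine hγ.dependsOn_kernelApply Λ hf fun x hx => ?_
  by_cases hV : x ∈ V
  · simpa [glue, hV] using h x ⟨hV, hx⟩
  · simp [glue, hV]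

variable [LinearOrder S]

theorem IsMonotonicityPreserving.monotone_kernelApply_glue (hmono : IsMonotonicityPreserving γ)
    (θ : L → S) (Λ V : Finset L) {f : (L → S) → ℝ} (hf : Measurable f) (hm : Monotone f) :
    Monotone fun ω => kernelApply γ Λ f (glue V ω θ) :=
  (hmono Λ f hf hm).comp (glue_mono V θ)

theorem IsMonotonicityPreserving.antitone_kernelApply_glue (hmono : IsMonotonicityPreserving γ)
    (hθ : IsTop θ) (Λ : Finset L) {f : (L → S) → ℝ} (hf : Measurable f) (hm : Monotone f)
    (ω : L → S) : Antitone fun V : Finset L => kernelApply γ Λ f (glue V ω θ) :=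
  (hmono Λ f hf hm).comp_antitone (antitone_glue hθ ω)

end GluedBoundary

/-! ### The limits with maximal boundary condition -/

section UpperLimit

variable {L S : Type*} [Finite S] [LinearOrder S] [TopologicalSpace S]
  [DiscreteTopology S] [MeasurableSpace S] [BorelSpace S] {γ : KernelFamily L S} {θ : L → S}

/-- By consistency the larger kernel averages γ_Λ f, an increasing function that is largest at θ.
This monotonicity in the volume is what makes μ^+ exist. -/
theorem kernelApply_le_top (hmono : IsMonotonicityPreserving γ) (hγ : IsSpecification γ)
    (hθ : IsTop θ) {Λ Λ' : Finset L} (h : Λ ⊆ Λ') {f : (L → S) → ℝ} (hf : IsLocal f)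
    (hm : Monotone f) : kernelApply γ Λ' f θ ≤ kernelApply γ Λ f θ := by
  obtain ⟨M, -, hM⟩ := hf.exists_bound
  rw [← hγ.kernelApply_kernelApply h hf.measurable hM]
  have h1 : kernelApply γ Λ' (fun _ => kernelApply γ Λ f θ) θ = kernelApply γ Λ f θ := by
    simp [kernelApply]
  conv_rhs => rw [← h1]
  exact integral_mono (integrable_of_abs_le (hγ.measurable_kernelApply' Λ hf.measurable)
    (abs_kernelApply_le hM Λ) _) (integrable_const _) fun σ => hmono Λ f hf.measurable hm (hθ σ)

variable [Countable L]

theorem tendsto_directionLimit (hmono : IsMonotonicityPreserving γ) (hθ : IsTop θ) (Λ : Finset L)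
    (ω : L → S) :
    Tendsto (fun V : Finset L => γ Λ (glue V ω θ)) atTop (𝓝 (directionLimit γ θ Λ ω)) := by
  have h : ∃ Q, Tendsto (fun V : Finset L => γ Λ (glue V ω θ)) atTop (𝓝 Q) := by
    refine exists_tendsto_of_monotone_local fun f hf hm => ?_
    obtain ⟨M, -, hM⟩ := hf.exists_bound
    exact ⟨_, tendsto_atTop_ciInf (hmono.antitone_kernelApply_glue hθ Λ hf.measurable hm ω)
      (bddBelow_range_of_abs_le fun V => abs_kernelApply_le hM Λ _)⟩
  exact tendsto_nhds_limUnder h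

theorem tendsto_kernelApply_directionLimit (hmono : IsMonotonicityPreserving γ) (hθ : IsTop θ)
    (Λ : Finset L) (ω : L → S) {f : (L → S) → ℝ} (hf : IsLocal f) :
    Tendsto (fun V : Finset L => kernelApply γ Λ f (glue V ω θ)) atTop
      (𝓝 (kernelApply (directionLimit γ θ) Λ f ω)) :=
  tendsto_integral_of_tendsto (tendsto_directionLimit hmono hθ Λ ω) hf

theorem kernelApply_directionLimit_le (hmono : IsMonotonicityPreserving γ) (hθ : IsTop θ)
    (Λ V : Finset L) (ω : L → S) {f : (L → S) → ℝ} (hf : IsLocal f) (hm : Monotone f) :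
    kernelApply (directionLimit γ θ) Λ f ω ≤ kernelApply γ Λ f (glue V ω θ) :=
  (hmono.antitone_kernelApply_glue hθ Λ hf.measurable hm ω).le_of_tendsto
    (tendsto_kernelApply_directionLimit hmono hθ Λ ω hf) V

theorem tendsto_boundaryLimit (hmono : IsMonotonicityPreserving γ) (hγ : IsSpecification γ)
    (hθ : IsTop θ) : Tendsto (fun Λ : Finset L => γ Λ θ) atTop (𝓝 (boundaryLimit γ θ)) := by
  have h : ∃ Q, Tendsto (fun Λ : Finset L => γ Λ θ) atTop (𝓝 Q) := by
    refine exists_tendsto_of_monotone_local fun f hf hm => ?_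
    obtain ⟨M, -, hM⟩ := hf.exists_bound
    exact ⟨_, tendsto_atTop_ciInf (fun Λ Λ' hΛ => kernelApply_le_top hmono hγ hθ hΛ hf hm)
      (bddBelow_range_of_abs_le fun Λ => abs_kernelApply_le hM Λ θ)⟩
  exact tendsto_nhds_limUnder h

theorem measurable_kernelApply_directionLimit (hmono : IsMonotonicityPreserving γ)
    (hγ : IsSpecification γ) (hθ : IsTop θ) (Λ : Finset L) {f : (L → S) → ℝ} (hf : IsLocal f) :
    Measurable[cylinderEvents ((Λ : Set L)ᶜ)] (kernelApply (directionLimit γ θ) Λ f) := by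
  refine @measurable_of_tendsto_metrizable' _ _ (cylinderEvents ((Λ : Set L)ᶜ)) _ _ _ _
    (Finset L) (fun V ω => kernelApply γ Λ f (glue V ω θ)) _ atTop _ _ (fun V => ?_) ?_
  · exact @Measurable.comp _ _ _ (cylinderEvents ((Λ : Set L)ᶜ)) (cylinderEvents ((Λ : Set L)ᶜ)) _
      _ _ (hγ.measurable_kernelApply Λ hf.measurable) (measurable_glue_cylinderEvents V θ _)
  · exact tendsto_pi_nhds.2 fun ω => tendsto_kernelApply_directionLimit hmono hθ Λ ω hf

theorem tendsto_integral_kernelApply_glue (hmono : IsMonotonicityPreserving γ)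
    (hθ : IsTop θ) (Λ : Finset L) {f : (L → S) → ℝ} (hf : IsLocal f)
    (P : Measure (L → S)) [IsFiniteMeasure P] :
    Tendsto (fun V : Finset L => ∫ ω, kernelApply γ Λ f (glue V ω θ) ∂P) atTop
      (𝓝 (∫ ω, kernelApply (directionLimit γ θ) Λ f ω ∂P)) := by
  obtain ⟨M, -, hM⟩ := hf.exists_bound
  exact tendsto_integral_filter_of_dominated_convergence (fun _ => M)
    (Eventually.of_forall fun V =>
      (isLocal_kernelApply_glue γ θ Λ V f).measurable.aestronglyMeasurable)
    (Eventually.of_forall fun V => Eventually.of_forall fun ω => abs_kernelApply_le hM Λ _)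
    (integrable_const _)
    (Eventually.of_forall fun ω => tendsto_kernelApply_directionLimit hmono hθ Λ ω hf)

/-- Limits of the measures `γ_{Δ_i}(· | ω_i)`, where `ω_i` equals `θ` outside a finite set,
satisfy the DLR equations for `directionLimit γ θ`, provided the limit is attained from above. -/
theorem integral_kernelApply_directionLimit (hmono : IsMonotonicityPreserving γ)
    (hγ : IsSpecification γ) (hθ : IsTop θ) {ι : Type*} {l : Filter ι} [l.NeBot]
    {Δ W : ι → Finset L} {ω : ι → L → S} {Q : ProbabilityMeasure (L → S)}
    (hω : ∀ i, ∀ x ∉ W i, ω i x = θ x) (hQ : Tendsto (fun i => γ (Δ i) (ω i)) l (𝓝 Q))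
    {Λ : Finset L} (hΛ : ∀ᶠ i in l, Λ ⊆ Δ i)
    (hle : ∀ g : (L → S) → ℝ, IsLocal g → Monotone g → ∀ i,
      ∫ σ, g σ ∂(Q : Measure (L → S)) ≤ kernelApply γ (Δ i) g (ω i))
    {f : (L → S) → ℝ} (hf : IsLocal f) (hm : Monotone f) :
    ∫ σ, kernelApply (directionLimit γ θ) Λ f σ ∂(Q : Measure (L → S)) =
      ∫ σ, f σ ∂(Q : Measure (L → S)) := by
  classical
  obtain ⟨M, -, hM⟩ := hf.exists_bound
  have hlim := tendsto_integral_kernelApply_glue hmono hθ Λ hf (Q : Measure (L → S))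
  have hfQ := tendsto_integral_of_tendsto hQ hf
  apply le_antisymm
  -- Upper bound: fix i and take V so large that γ_{Δ_i}(· | ω_i) charges only configurations equal
  -- to θ off V. Gluing then changes nothing, and `hle` applies to the local increasing function γ_Λ
  -- f(σ_V θ).
  · refine ge_of_tendsto hfQ (hΛ.mono fun i hi => le_of_tendsto hlim ?_)
    filter_upwards [eventually_ge_atTop (W i ∪ Δ i)] with V hV
    refine (hle _ (isLocal_kernelApply_glue γ θ Λ V f)
      (hmono.monotone_kernelApply_glue θ Λ V hf.measurable hm) i).trans_eq ?_
    change _ = kernelApply γ (Δ i) f (ω i)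
    rw [← hγ.kernelApply_kernelApply hi hf.measurable hM]
    refine hγ.kernelApply_congr fun σ hσ => ?_
    rw [glue_eq_self fun x hx => ?_]
    rw [hσ x fun h => hx (hV (Finset.mem_union_right _ h)),
      hω i x fun h => hx (hV (Finset.mem_union_left _ h))]
  -- Lower bound: fix V and use γ_Λ f(σ) ≤ γ_Λ f(σ_V θ), whose right side is local, before passing
  -- to the limit in i.
  · refine ge_of_tendsto hlim (Eventually.of_forall fun V => ?_)
    refine le_of_tendsto_of_tendsto hfQ
      (tendsto_integral_of_tendsto hQ (isLocal_kernelApply_glue γ θ Λ V f))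
      (hΛ.mono fun i hi => ?_)
    change kernelApply γ (Δ i) f (ω i) ≤ _
    rw [← hγ.kernelApply_kernelApply hi hf.measurable hM]
    exact integral_mono (integrable_of_abs_le (hγ.measurable_kernelApply' Λ hf.measurable)
      (abs_kernelApply_le hM Λ) _) ((isLocal_kernelApply_glue γ θ Λ V f).integrable _)
      fun σ => hmono Λ f hf.measurable hm (le_glue hθ V σ)

/-- Consistency is the DLR equation for the weak limit of γ_{Λ'}(· | ω_V θ) as V grows. On
increasing functions this limit is decreasing, as `integral_kernelApply_directionLimit` requires. -/
theorem isSpecification_directionLimit (hmono : IsMonotonicityPreserving γ)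
    (hγ : IsSpecification γ) (hθ : IsTop θ) : IsSpecification (directionLimit γ θ) := by
  classical
  refine isSpecification_of_local
    (fun Λ f hf => measurable_kernelApply_directionLimit hmono hγ hθ Λ hf)
    (fun Λ ω x hx => ?_) (fun Λ Λ' hΛ ω f hf hm => ?_)
  · have hloc : IsLocal ({σ : L → S | σ x = ω x}.indicator fun _ => (1 : ℝ)) :=
      ⟨{x}, fun σ τ h => by
        have : σ x = τ x := h x (by simp)
        simp [Set.indicator, this]⟩
    have hms : MeasurableSet {σ : L → S | σ x = ω x} :=
      measurable_pi_apply (X := fun _ => S) x (measurableSet_singleton (ω x))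
    have h1 := tendsto_kernelApply_directionLimit hmono hθ Λ ω hloc
    have h2 : ∀ᶠ V : Finset L in atTop, kernelApply γ Λ
        ({σ : L → S | σ x = ω x}.indicator fun _ => (1 : ℝ)) (glue V ω θ) = 1 := by
      filter_upwards [eventually_ge_atTop {x}] with V hV
      have hxV : x ∈ V := hV (by simp)
      rw [hγ.kernelApply_congr (g := fun _ => 1) fun σ hσ => ?_]
      · simp [kernelApply]
      · refine Set.indicator_of_mem ?_ _
        simpa [glue, hxV] using hσ x hx
    have h3 := tendsto_nhds_unique h1 (tendsto_const_nhds.congr' (h2.mono fun V hV => hV.symm))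
    simp only [kernelApply] at h3
    rw [integral_indicator_const _ hms] at h3
    simp only [smul_eq_mul, mul_one, Measure.real] at h3
    have h4 : (directionLimit γ θ Λ ω : Measure (L → S)) {σ : L → S | σ x = ω x} = 1 :=
      (ENNReal.toReal_eq_one_iff _).1 h3
    exact (prob_compl_eq_zero_iff hms).2 h4
  · exact integral_kernelApply_directionLimit hmono hγ hθ (W := fun V => V)
      (fun V x hx => glue_apply_of_notMem hx ω θ) (tendsto_directionLimit hmono hθ Λ' ω)
      (Eventually.of_forall fun _ => hΛ)
      (fun g hg hgm V => kernelApply_directionLimit_le hmono hθ Λ' V ω hg hgm) hf hm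

theorem limitsExist (hmono : IsMonotonicityPreserving γ) (hγ : IsSpecification γ)
    (hθ : IsTop θ) : LimitsExist γ θ :=
  ⟨tendsto_directionLimit hmono hθ, isSpecification_directionLimit hmono hγ hθ,
    tendsto_boundaryLimit hmono hγ hθ⟩

/-- The other instance of `integral_kernelApply_directionLimit`: the boundary condition stays θ, so
no exceptional set is needed, and the volume grows. -/
theorem isConsistentWith_boundaryLimit (hmono : IsMonotonicityPreserving γ)
    (hγ : IsSpecification γ) (hθ : IsTop θ) :
    IsConsistentWith (boundaryLimit γ θ) (directionLimit γ θ) := by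
  refine isConsistentWith_of_monotone_local (isSpecification_directionLimit hmono hγ hθ)
    fun Λ f hf hm => ?_
  refine integral_kernelApply_directionLimit hmono hγ hθ (Δ := id) (W := fun _ => ∅)
    (ω := fun _ => θ) (fun _ _ _ => rfl) (tendsto_boundaryLimit hmono hγ hθ)
    (eventually_ge_atTop Λ) (fun g hg hgm Δ => ?_) hf hm
  exact Antitone.le_of_tendsto (fun Λ Λ' hΛ => kernelApply_le_top hmono hγ hθ hΛ hg hgm)
    (tendsto_integral_of_tendsto (tendsto_boundaryLimit hmono hγ hθ) hg) Δ

end UpperLimit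

/-! ### Reversing the order: minimal boundary condition -/

section Duality

/-- The reversed order on the same type. -/
abbrev dualLinearOrder (S : Type*) [LinearOrder S] : LinearOrder S :=
  inferInstanceAs (LinearOrder Sᵒᵈ)

theorem kernelApply_neg {L S : Type*} [MeasurableSpace S] (γ : KernelFamily L S) (Λ : Finset L)
    (f : (L → S) → ℝ) (ω : L → S) : kernelApply γ Λ (fun σ => -f σ) ω = -kernelApply γ Λ f ω :=
  integral_neg _

theorem monotone_dual_iff {L S : Type*} [o : LinearOrder S] {f : (L → S) → ℝ} :
    (letI := dualLinearOrder S; Monotone f) ↔ Antitone f :=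
  ⟨fun h _ _ hab => h hab, fun h _ _ hab => h hab⟩

theorem IsLocal.neg {L S : Type*} {f : (L → S) → ℝ} (hf : IsLocal f) : IsLocal fun σ => -f σ :=
  hf.comp_left _

/-- Replacing f by -f exchanges the two orders. Results for the maximal boundary condition thereby
transfer to the minimal one without a second proof. -/
theorem IsMonotonicityPreserving.dual {L S : Type*} [MeasurableSpace S] [LinearOrder S]
    {γ : KernelFamily L S} (h : IsMonotonicityPreserving γ) :
    @IsMonotonicityPreserving L S _ (dualLinearOrder S) γ := by
  intro Λ f hf hm
  have h1 : Monotone (kernelApply γ Λ fun σ => -f σ) :=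
    h Λ _ hf.neg (monotone_dual_iff.1 hm).neg
  refine monotone_dual_iff.2 fun σ τ hst => ?_
  have := h1 hst
  rw [kernelApply_neg, kernelApply_neg] at this
  linarith

variable {L S : Type*} [Finite S] [LinearOrder S] [TopologicalSpace S] [DiscreteTopology S]
  [MeasurableSpace S] [BorelSpace S] {γ : KernelFamily L S} {θ : L → S} [Countable L]

theorem le_kernelApply_directionLimit (hmono : IsMonotonicityPreserving γ) (hθ : IsBot θ)
    (Λ V : Finset L) (ω : L → S) {f : (L → S) → ℝ} (hf : IsLocal f) (hm : Monotone f) :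
    kernelApply γ Λ f (glue V ω θ) ≤ kernelApply (directionLimit γ θ) Λ f ω := by
  have := @kernelApply_directionLimit_le L S _ (dualLinearOrder S) _ _ _ _ γ θ _ hmono.dual hθ Λ V ω
    (fun σ => -f σ) hf.neg (monotone_dual_iff.2 hm.neg)
  rw [kernelApply_neg, kernelApply_neg] at this
  linarith

theorem limitsExist_of_isBot (hmono : IsMonotonicityPreserving γ) (hγ : IsSpecification γ)
    (hθ : IsBot θ) : LimitsExist γ θ :=
  @limitsExist L S _ (dualLinearOrder S) _ _ _ _ γ θ _ hmono.dual hγ hθ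

theorem isConsistentWith_boundaryLimit_of_isBot (hmono : IsMonotonicityPreserving γ)
    (hγ : IsSpecification γ) (hθ : IsBot θ) :
    IsConsistentWith (boundaryLimit γ θ) (directionLimit γ θ) :=
  @isConsistentWith_boundaryLimit L S _ (dualLinearOrder S) _ _ _ _ γ θ _ hmono.dual hγ hθ

variable {η : L → S}

theorem kernelApply_bot_le_top (hmono : IsMonotonicityPreserving γ) (hθ : IsTop θ)
    (hη : IsBot η) (Λ : Finset L) (ω : L → S) {f : (L → S) → ℝ} (hf : IsLocal f)
    (hm : Monotone f) :
    kernelApply (directionLimit γ η) Λ f ω ≤ kernelApply (directionLimit γ θ) Λ f ω :=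
  le_of_tendsto_of_tendsto'
    (@tendsto_kernelApply_directionLimit L S _ (dualLinearOrder S) _ _ _ _ γ η _ hmono.dual hη Λ ω
      f hf)
    (tendsto_kernelApply_directionLimit hmono hθ Λ ω hf) fun V => by
    exact hmono Λ f hf.measurable hm (glue_mono_right V ω (hθ η))

end Duality

/-! ### Continuity of the limiting kernels on the agreement set -/

section Continuity

theorem agreementSet_comm {L S : Type*} [MeasurableSpace S] (γ γ' : KernelFamily L S) :
    agreementSet γ γ' = agreementSet γ' γ :=
  Set.ext fun _ => ⟨fun h Λ f hf => (h Λ f hf).symm, fun h Λ f hf => (h Λ f hf).symm⟩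

theorem kernelApply_sub {L S : Type*} [Finite S] [MeasurableSpace S] [MeasurableSingletonClass S]
    (γ : KernelFamily L S) (Λ : Finset L) {f g : (L → S) → ℝ}
    (hf : IsLocal f) (hg : IsLocal g) :
    kernelApply γ Λ (fun σ => f σ - g σ) = fun ω => kernelApply γ Λ f ω - kernelApply γ Λ g ω :=
  funext fun _ => integral_sub (hf.integrable _) (hg.integrable _)

theorem eventually_eqOn_finset {L S : Type*} [TopologicalSpace S] [DiscreteTopology S]
    (V : Finset L) (ω : L → S) :
    ∀ᶠ ω' in 𝓝 ω, ∀ x ∈ V, ω' x = ω x := by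
  rw [Filter.eventually_all_finset]
  intro x _
  have h : {s : S | s = ω x} ∈ 𝓝 (ω x) := (isOpen_discrete _).mem_nhds rfl
  exact (continuous_apply x).continuousAt h

variable {L S : Type*} [Finite S] [LinearOrder S] [TopologicalSpace S] [DiscreteTopology S]
  [MeasurableSpace S] [BorelSpace S] {γ : KernelFamily L S} {θ η : L → S}

theorem mem_continuitySet_of_monotone {ω : L → S}
    (h : ∀ (Λ : Finset L) (f : (L → S) → ℝ), IsLocal f → Monotone f →
      ContinuousAt (kernelApply γ Λ f) ω) : ω ∈ continuitySet γ := by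
  intro Λ f hf
  obtain ⟨a, b, ha, hb, hma, hmb, rfl⟩ := hf.exists_monotone_sub
  rw [kernelApply_sub γ Λ ha hb]
  exact (h Λ a ha hma).sub (h Λ b hb hmb)

variable [Countable L]

/-- Where the upper and the lower limit agree, both are continuous. -/
theorem agreementSet_subset_continuitySet (hmono : IsMonotonicityPreserving γ) (hθ : IsTop θ)
    (hη : IsBot η) :
    agreementSet (directionLimit γ θ) (directionLimit γ η) ⊆
      continuitySet (directionLimit γ θ) ∩ continuitySet (directionLimit γ η) := by
  intro ω hω
  -- At ω the two glued kernels come within ε of the common limit for one finite V. They depend only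
  -- on the spins in V, so they still bound the limiting kernels from both sides near ω.
  have key : ∀ (Λ : Finset L) (f : (L → S) → ℝ), IsLocal f → Monotone f → ∀ ε > 0,
      ∀ᶠ ω' in 𝓝 ω, kernelApply (directionLimit γ θ) Λ f ω - ε <
        kernelApply (directionLimit γ η) Λ f ω' ∧
        kernelApply (directionLimit γ θ) Λ f ω' <
          kernelApply (directionLimit γ θ) Λ f ω + ε := by
    intro Λ f hf hm ε hε
    have h1 := (tendsto_kernelApply_directionLimit hmono hθ Λ ω hf).eventually_lt_const
      (lt_add_of_pos_right _ hε)
    have h2 := (@tendsto_kernelApply_directionLimit L S _ (dualLinearOrder S) _ _ _ _ γ η _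
      hmono.dual hη Λ ω f hf).eventually_const_lt (sub_lt_self _ hε)
    obtain ⟨V, hV1, hV2⟩ := (h1.and h2).exists
    filter_upwards [eventually_eqOn_finset V ω] with ω' hω'
    have e1 : glue V ω' θ = glue V ω θ := dependsOn_glue V θ hω'
    have e2 : glue V ω' η = glue V ω η := dependsOn_glue V η hω'
    rw [← e1] at hV1
    rw [← e2, ← hω Λ f hf] at hV2
    exact ⟨hV2.trans_le (le_kernelApply_directionLimit hmono hη Λ V ω' hf hm),
      (kernelApply_directionLimit_le hmono hθ Λ V ω' hf hm).trans_lt hV1⟩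
  refine ⟨mem_continuitySet_of_monotone fun Λ f hf hm => Metric.tendsto_nhds.2 fun ε hε => ?_,
    mem_continuitySet_of_monotone fun Λ f hf hm => Metric.tendsto_nhds.2 fun ε hε => ?_⟩
  · filter_upwards [key Λ f hf hm ε hε] with ω' h
    have := kernelApply_bot_le_top hmono hθ hη Λ ω' hf hm
    rw [Real.dist_eq, abs_lt]
    constructor <;> linarith [h.1, h.2]
  · filter_upwards [key Λ f hf hm ε hε] with ω' h
    have := kernelApply_bot_le_top hmono hθ hη Λ ω' hf hm
    rw [Real.dist_eq, abs_lt, ← hω Λ f hf]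
    constructor <;> linarith [h.1, h.2]

theorem measure_continuitySet_eq_one (hmono : IsMonotonicityPreserving γ)
    (hθ : IsTop θ) (hη : IsBot η) {μ : ProbabilityMeasure (L → S)}
    (h : (μ : Measure (L → S)) (agreementSet (directionLimit γ θ) (directionLimit γ η)) = 1) :
    (μ : Measure (L → S)) (continuitySet (directionLimit γ θ)) = 1 ∧
      (μ : Measure (L → S)) (continuitySet (directionLimit γ η)) = 1 := by
  have hs := agreementSet_subset_continuitySet hmono hθ hη
  exact ⟨le_antisymm prob_le_one (h ▸ measure_mono fun ω hω => (hs hω).1),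
    le_antisymm prob_le_one (h ▸ measure_mono fun ω hω => (hs hω).2)⟩

end Continuity

/-! ### Translation invariance of the extremal measures -/

section Invariance

variable {L S : Type*} {d : ℕ} [AddAction (Fin d → ℤ) L]

/-- The translate `τ_i Λ` of a finite set. -/
abbrev shift (i : Fin d → ℤ) (Λ : Finset L) : Finset L :=
  Λ.map (AddAction.toPerm i).toEmbedding

theorem mem_shift {i : Fin d → ℤ} {Λ : Finset L} {x : L} : x ∈ shift i Λ ↔ -i +ᵥ x ∈ Λ := by
  simp only [shift, Finset.mem_map_equiv]
  rfl

theorem shift_neg_shift (i : Fin d → ℤ) (Λ : Finset L) : shift (-i) (shift i Λ) = Λ := by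
  ext x
  simp

theorem measurable_translateConfig [MeasurableSpace S] (i : Fin d → ℤ) :
    Measurable (translateConfig (L := L) (S := S) i) :=
  measurable_pi_lambda _ fun _ => measurable_pi_apply _

theorem _root_.DependsOn.comp_translateConfig {α : Type*} {f : (L → S) → α} {Δ : Finset L}
    (hf : DependsOn f (Δ : Set L)) (i : Fin d → ℤ) :
    DependsOn (fun σ => f (translateConfig i σ)) (shift (-i) Δ : Set L) := by
  intro σ τ h
  refine hf fun x hx => h (-i +ᵥ x) ?_
  rw [Finset.mem_coe, mem_shift]
  simpa using hx

theorem IsLocal.comp_translateConfig {f : (L → S) → ℝ} (hf : IsLocal f) (i : Fin d → ℤ) :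
    IsLocal fun σ => f (translateConfig i σ) := by
  obtain ⟨Δ, hΔ⟩ := hf
  exact ⟨_, hΔ.comp_translateConfig i⟩

theorem tendsto_shift_atTop (i : Fin d → ℤ) :
    Tendsto (shift (L := L) i) atTop atTop := by
  refine tendsto_atTop.2 fun V => ?_
  filter_upwards [eventually_ge_atTop (shift (-i) V)] with Λ hΛ x hx
  rw [mem_shift]
  refine hΛ ?_
  rw [mem_shift]
  simpa using hx

variable [Finite S] [LinearOrder S] [TopologicalSpace S] [DiscreteTopology S]
  [MeasurableSpace S] [BorelSpace S] {γ : KernelFamily L S} {θ : L → S} [Countable L]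

/-- The maximal configuration is fixed by translations, so τ_i maps γ_Λ(· | θ) to γ_{τ_iΛ}(· | θ);
the volumes τ_iΛ exhaust the lattice along with Λ and give the same limit. -/
theorem isInvariantMeasure_boundaryLimit (hmono : IsMonotonicityPreserving γ)
    (hγ : IsSpecification γ) (hinv : IsInvariantFamily d γ) (hθ : IsTop θ) :
    IsInvariantMeasure d (boundaryLimit γ θ) := by
  intro i
  have hp : IsProbabilityMeasure
      ((boundaryLimit γ θ : Measure (L → S)).map (translateConfig i)) :=
    Measure.isProbabilityMeasure_map (measurable_translateConfig i).aemeasurable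
  suffices (⟨_, hp⟩ : ProbabilityMeasure (L → S)) = boundaryLimit γ θ from
    congrArg ProbabilityMeasure.toMeasure this
  have hθi : translateConfig i θ = θ :=
    funext fun x => le_antisymm (hθ (fun _ => θ (-i +ᵥ x)) x) (hθ (fun _ => θ x) (-i +ᵥ x))
  refine measure_eq_of_monotone_local fun f hf _ => ?_
  change ∫ σ, f σ ∂((boundaryLimit γ θ : Measure (L → S)).map (translateConfig i)) = _
  rw [integral_map (measurable_translateConfig i).aemeasurable
    hf.measurable.aestronglyMeasurable]
  have h1 := tendsto_integral_of_tendsto (tendsto_boundaryLimit hmono hγ hθ)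
    (hf.comp_translateConfig i)
  have h2 := (tendsto_integral_of_tendsto (tendsto_boundaryLimit hmono hγ hθ) hf).comp
    (tendsto_shift_atTop i)
  refine tendsto_nhds_unique h1 (h2.congr fun Λ => ?_)
  have := hinv i Λ θ
  rw [hθi] at this
  rw [Function.comp_apply, this, integral_map (measurable_translateConfig i).aemeasurable
    hf.measurable.aestronglyMeasurable]

end Invariance

/-! ### Stochastic domination conditional on finitely many spins -/

section Comparison

/-- The event that the spins in `V` are those of `ξ`. -/
def spinsEq {L S : Type*} (V : Finset L) (ξ : L → S) : Set (L → S) := {σ | ∀ x ∈ V, σ x = ξ x}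

theorem dependsOn_indicator_spinsEq {L S : Type*} (V : Finset L) (ξ : L → S) :
    DependsOn ((spinsEq V ξ).indicator fun _ => (1 : ℝ)) (V : Set L) := by
  intro σ τ h
  have : σ ∈ spinsEq V ξ ↔ τ ∈ spinsEq V ξ :=
    forall₂_congr fun x hx => by rw [h x hx]
  by_cases hσ : σ ∈ spinsEq V ξ
  · rw [Set.indicator_of_mem hσ, Set.indicator_of_mem (this.1 hσ)]
  · rw [Set.indicator_of_notMem hσ, Set.indicator_of_notMem (mt this.2 hσ)]

theorem isLocal_indicator_spinsEq {L S : Type*} (V : Finset L) (ξ : L → S) :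
    IsLocal ((spinsEq V ξ).indicator fun _ => (1 : ℝ)) := ⟨V, dependsOn_indicator_spinsEq V ξ⟩

theorem measurableSet_spinsEq {L S : Type*} [MeasurableSpace S] [MeasurableSingletonClass S]
    (V : Finset L) (ξ : L → S) : MeasurableSet (spinsEq V ξ) := by
  have : spinsEq V ξ = ⋂ x ∈ V, (fun σ : L → S => σ x) ⁻¹' {ξ x} := by
    ext σ
    simp [spinsEq]
  rw [this]
  exact V.measurableSet_biInter fun x _ => measurable_pi_apply x (measurableSet_singleton _)

/-- First resample Λ∖U. The indicator factors out, and on the event the boundary condition seen by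
Λ∖U is ξ on U and θ outside U ∪ Λ, so the inner average is constant. -/
theorem IsSpecification.kernelApply_indicator_spinsEq_mul {L S : Type*} [Countable L] [Finite S]
    [MeasurableSpace S] [MeasurableSingletonClass S] {γ : KernelFamily L S} [DecidableEq L]
    (hγ : IsSpecification γ) (U Λ : Finset L) (ξ θ : L → S) {g : (L → S) → ℝ}
    (hg : IsLocal g) :
    kernelApply γ Λ (fun σ => (spinsEq U ξ).indicator (fun _ => 1) σ * g σ) θ =
      kernelApply γ (Λ \ U) g (glue U ξ θ) *
        kernelApply γ Λ ((spinsEq U ξ).indicator fun _ => 1) θ := by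
  have hloc := (isLocal_indicator_spinsEq U ξ).mul hg
  obtain ⟨M, -, hM⟩ := hloc.exists_bound
  rw [← hγ.kernelApply_kernelApply (Finset.sdiff_subset : Λ \ U ⊆ Λ) hloc.measurable hM]
  refine Eq.trans (hγ.kernelApply_congr fun σ hσ => ?_) (integral_const_mul _ _)
  rw [hγ.kernelApply_mul σ ((dependsOn_indicator_spinsEq U ξ).mono fun x hx => by
    simpa using fun _ => hx)]
  by_cases hσC : σ ∈ spinsEq U ξ
  · rw [hγ.dependsOn_kernelApply (Λ \ U) hg.measurable (x := σ) (y := glue U ξ θ)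
      fun x hx => ?_, mul_comm]
    by_cases hxU : x ∈ U
    · rw [glue_apply_of_mem hxU, hσC x hxU]
    · rw [glue_apply_of_notMem hxU, hσ x fun hxΛ => hx (by simp [hxΛ, hxU])]
  · simp [hσC]

variable {L S : Type*} [Finite S] [LinearOrder S] [TopologicalSpace S] [DiscreteTopology S]
  [MeasurableSpace S] [BorelSpace S] {γ : KernelFamily L S} {θ η : L → S} [Countable L]

/-- Conditionally on finitely many spins, the lower limit measure is dominated by the upper
one. -/
theorem integral_spinsEq_mul_le (hmono : IsMonotonicityPreserving γ) (hγ : IsSpecification γ)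
    (hθ : IsTop θ) (hη : IsBot η) (U : Finset L) (ξ : L → S) {g : (L → S) → ℝ} (hg : IsLocal g)
    (hm : Monotone g) :
    (∫ σ, (spinsEq U ξ).indicator (fun _ => 1) σ * g σ ∂(boundaryLimit γ η : Measure (L → S))) *
        (boundaryLimit γ θ : Measure (L → S)).real (spinsEq U ξ) ≤
      (∫ σ, (spinsEq U ξ).indicator (fun _ => 1) σ * g σ ∂(boundaryLimit γ θ : Measure (L → S))) *
        (boundaryLimit γ η : Measure (L → S)).real (spinsEq U ξ) := by
  classical
  have hbot : Tendsto (fun Λ : Finset L => γ Λ η) atTop (𝓝 (boundaryLimit γ η)) :=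
    (limitsExist_of_isBot hmono hγ hη).2.2
  have htop := tendsto_boundaryLimit hmono hγ hθ
  have hind := isLocal_indicator_spinsEq U ξ
  have hreal : ∀ P : Measure (L → S), P.real (spinsEq U ξ) =
      ∫ σ, (spinsEq U ξ).indicator (fun _ => (1 : ℝ)) σ ∂P := fun P => by
    rw [integral_indicator_const _ (measurableSet_spinsEq U ξ)]
    simp
  rw [hreal, hreal]
  refine le_of_tendsto_of_tendsto
    ((tendsto_integral_of_tendsto hbot (hind.mul hg)).mul (tendsto_integral_of_tendsto htop hind))
    ((tendsto_integral_of_tendsto htop (hind.mul hg)).mul (tendsto_integral_of_tendsto hbot hind))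
    ?_
  refine Eventually.of_forall fun Λ => ?_
  change kernelApply γ Λ _ η * kernelApply γ Λ _ θ ≤ kernelApply γ Λ _ θ * kernelApply γ Λ _ η
  rw [hγ.kernelApply_indicator_spinsEq_mul U Λ ξ η hg, hγ.kernelApply_indicator_spinsEq_mul U Λ ξ θ hg]
  -- Both sides carry the same product of event probabilities, so only the boundary conditions
  -- outside U are compared. The product form avoids dividing by a possibly zero probability.
  have hle : kernelApply γ (Λ \ U) g (glue U ξ η) ≤ kernelApply γ (Λ \ U) g (glue U ξ θ) := by
    exact hmono _ g hg.measurable hm (glue_mono_right U ξ (hθ η))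
  have h0 : ∀ ζ, 0 ≤ kernelApply γ Λ ((spinsEq U ξ).indicator fun _ => 1) ζ := fun ζ =>
    integral_nonneg fun σ => Set.indicator_nonneg (fun _ _ => zero_le_one) σ
  have := mul_le_mul_of_nonneg_right hle (mul_nonneg (h0 η) (h0 θ))
  linarith

end Comparison

/-! ### Finite-volume densities, entropy and the Hellinger estimate -/

section Density

variable {L S : Type*} [MeasurableSpace S]

/-- The density, at the spins in `V`, of `μ` with respect to `ν`. -/
noncomputable def spinDensity (μ ν : ProbabilityMeasure (L → S)) (V : Finset L) (σ : L → S) : ℝ :=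
  (μ : Measure (L → S)).real (spinsEq V σ) / (ν : Measure (L → S)).real (spinsEq V σ)

/-- The relative entropy `H_V(μ | ν)` as a real number. -/
noncomputable def spinEntropy (μ ν : ProbabilityMeasure (L → S)) (V : Finset L) : ℝ :=
  ∫ σ, Real.log (spinDensity μ ν V σ) ∂(μ : Measure (L → S))

variable {μ ν : ProbabilityMeasure (L → S)} {U V : Finset L}

theorem dependsOn_spinDensity (μ ν : ProbabilityMeasure (L → S)) (V : Finset L) :
    DependsOn (spinDensity μ ν V) (V : Set L) := by
  intro σ τ h
  have : spinsEq V σ = spinsEq V τ :=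
    Set.ext fun ρ => forall₂_congr fun x hx => by rw [h x hx]
  simp only [spinDensity, this]

theorem spinDensity_nonneg (μ ν : ProbabilityMeasure (L → S)) (V : Finset L) (σ : L → S) :
    0 ≤ spinDensity μ ν V σ :=
  div_nonneg measureReal_nonneg measureReal_nonneg

theorem isLocal_spinDensity (μ ν : ProbabilityMeasure (L → S)) (V : Finset L) :
    IsLocal (spinDensity μ ν V) := ⟨V, dependsOn_spinDensity μ ν V⟩

theorem ac_of_relEntropy_ne_top (h : relEntropy V μ ν ≠ ⊤) (hUV : U ⊆ V) :
    (μ : Measure (L → S)).map U.restrict ≪ (ν : Measure (L → S)).map U.restrict := by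
  have hr : Measurable (Finset.restrict₂ (π := fun _ : L => S) hUV) :=
    Finset.measurable_restrict₂ hUV
  have h1 := (InformationTheory.klDiv_ne_top_iff.1 h).1.map hr
  rwa [Measure.map_map hr (Finset.measurable_restrict V),
    Measure.map_map hr (Finset.measurable_restrict V),
    Finset.restrict₂_comp_restrict] at h1

variable [MeasurableSingletonClass S]

theorem measureReal_map_restrict_singleton (P : Measure (L → S)) (V : Finset L) (σ : L → S) :
    (P.map V.restrict).real {V.restrict σ} = P.real (spinsEq V σ) := by
  rw [map_measureReal_apply (Finset.measurable_restrict V) (measurableSet_singleton _)]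
  congr 1
  ext τ
  simp only [Set.mem_preimage, Set.mem_singleton_iff, spinsEq, Set.mem_ofPred_eq, funext_iff,
    Subtype.forall, Finset.restrict]

theorem measureReal_singleton_of_ac {α : Type*} [MeasurableSpace α] {P Q : Measure α}
    [IsFiniteMeasure P] [IsFiniteMeasure Q] (h : P ≪ Q) {A : Set α} (hA : Q.real A = 0) :
    P.real A = 0 := by
  rw [measureReal_eq_zero_iff] at hA ⊢
  exact h hA

/-- A μ-null cylinder stays null when refined; if the density vanishes by the convention x / 0 = 0,
absolute continuity gives μ-nullity too. This keeps the value log 0 = 0 harmless in entropy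
increments. -/
theorem spinDensity_eq_zero
    (hac : (μ : Measure (L → S)).map U.restrict ≪ (ν : Measure (L → S)).map U.restrict)
    (hUV : U ⊆ V) {σ : L → S} (h : spinDensity μ ν U σ = 0) : spinDensity μ ν V σ = 0 := by
  have : IsProbabilityMeasure ((μ : Measure (L → S)).map U.restrict) :=
    Measure.isProbabilityMeasure_map (Finset.measurable_restrict U).aemeasurable
  have : IsProbabilityMeasure ((ν : Measure (L → S)).map U.restrict) :=
    Measure.isProbabilityMeasure_map (Finset.measurable_restrict U).aemeasurable
  have hU : (μ : Measure (L → S)).real (spinsEq U σ) = 0 := by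
    rcases div_eq_zero_iff.1 h with h | h
    · exact h
    · rw [← measureReal_map_restrict_singleton] at h ⊢
      exact measureReal_singleton_of_ac hac h
  have hV : (μ : Measure (L → S)).real (spinsEq V σ) = 0 :=
    le_antisymm (hU ▸ measureReal_mono fun τ hτ x hx => hτ x (hUV hx)) measureReal_nonneg
  simp [spinDensity, hV]

variable [Finite S]

theorem integral_eq_sum_restrict [Fintype (V → S)] (P : ProbabilityMeasure (L → S))
    (g : (V → S) → ℝ) :
    ∫ σ, g (V.restrict σ) ∂(P : Measure (L → S)) =
      ∑ ξ, ((P : Measure (L → S)).map V.restrict).real {ξ} * g ξ := by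
  have hg : Measurable g := measurable_of_finite g
  have : IsProbabilityMeasure ((P : Measure (L → S)).map V.restrict) :=
    Measure.isProbabilityMeasure_map (Finset.measurable_restrict V).aemeasurable
  rw [← integral_map (Finset.measurable_restrict V).aemeasurable hg.aestronglyMeasurable,
    integral_fintype .of_finite]
  rfl

theorem integral_eq_integral_mul_spinDensity
    (hac : (μ : Measure (L → S)).map V.restrict ≪ (ν : Measure (L → S)).map V.restrict)
    {F : (L → S) → ℝ} (hF : DependsOn F (V : Set L)) :
    ∫ σ, F σ ∂(μ : Measure (L → S)) =
      ∫ σ, F σ * spinDensity μ ν V σ ∂(ν : Measure (L → S)) := by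
  classical
  have := Fintype.ofFinite (V → S)
  obtain ⟨g, rfl⟩ := exists_comp_restrict hF
  let R : (V → S) → ℝ := fun ξ => ((μ : Measure (L → S)).map V.restrict).real {ξ} /
    ((ν : Measure (L → S)).map V.restrict).real {ξ}
  have hR : ∀ σ, spinDensity μ ν V σ = R (V.restrict σ) := fun σ => by
    simp only [R, measureReal_map_restrict_singleton, spinDensity]
  simp only [hR, Function.comp_apply]
  rw [integral_eq_sum_restrict, integral_eq_sum_restrict ν fun ξ => g ξ * R ξ]
  have : IsProbabilityMeasure ((μ : Measure (L → S)).map V.restrict) :=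
    Measure.isProbabilityMeasure_map (Finset.measurable_restrict V).aemeasurable
  have : IsProbabilityMeasure ((ν : Measure (L → S)).map V.restrict) :=
    Measure.isProbabilityMeasure_map (Finset.measurable_restrict V).aemeasurable
  refine Finset.sum_congr rfl fun ξ _ => ?_
  by_cases h0 : ((ν : Measure (L → S)).map V.restrict).real {ξ} = 0
  · rw [h0, measureReal_singleton_of_ac hac h0]
    simp
  · simp only [R]
    field_simp

theorem integral_spinDensity
    (hac : (μ : Measure (L → S)).map V.restrict ≪ (ν : Measure (L → S)).map V.restrict) :
    ∫ σ, spinDensity μ ν V σ ∂(ν : Measure (L → S)) = 1 := by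
  have := integral_eq_integral_mul_spinDensity hac (F := fun _ => 1)
    ((dependsOn_const 1).mono (Set.empty_subset _))
  simpa using this.symm

/-- This is log t ≤ t - 1 at t = √b / √a, multiplied by 2a. -/
theorem two_mul_sub_le_mul_log_sub {a b : ℝ} (ha : 0 ≤ a) (hb : 0 ≤ b) (h : b = 0 → a = 0) :
    2 * a - 2 * (√a * √b) ≤ a * (Real.log a - Real.log b) := by
  rcases ha.eq_or_lt with rfl | ha
  · simp
  have hb : 0 < b := hb.lt_of_ne fun h' => ha.ne' (h h'.symm)
  have h1 := Real.log_le_sub_one_of_pos (div_pos (Real.sqrt_pos.2 hb) (Real.sqrt_pos.2 ha))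
  rw [Real.log_div (Real.sqrt_pos.2 hb).ne' (Real.sqrt_pos.2 ha).ne', Real.log_sqrt hb.le,
    Real.log_sqrt ha.le] at h1
  have h2 := mul_le_mul_of_nonneg_left h1 ha.le
  have h3 : a * (√b / √a - 1) = √a * √b - a := by
    have := (Real.sqrt_pos.2 ha).ne'
    have h4 : a / √a = √a := Real.div_sqrt
    rw [mul_sub, mul_one, mul_div_assoc', mul_div_right_comm, h4]
  rw [h3] at h2
  linarith

/-- Factor a - b = (√a - √b)(√a + √b), apply the weighted inequality xy ≤ x²/(2δ) + δy²/2, and bound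
(√a + √b)² by 2(a + b). Linear terms in this form replace Cauchy–Schwarz after integration. -/
theorem abs_sub_le_sqrt_sub_sq {a b δ : ℝ} (ha : 0 ≤ a) (hb : 0 ≤ b) (hδ : 0 < δ) :
    |a - b| ≤ (a + b - 2 * (√a * √b)) / (2 * δ) + δ * (a + b) := by
  have h1 : a - b = (√a - √b) * (√a + √b) := by
    ring_nf
    rw [Real.sq_sqrt ha, Real.sq_sqrt hb]
  have h2 : a + b - 2 * (√a * √b) = (√a - √b) ^ 2 := by
    ring_nf
    rw [Real.sq_sqrt ha, Real.sq_sqrt hb]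
    ring
  have h3 : (√a + √b) ^ 2 ≤ 2 * (a + b) := by
    nlinarith [sq_nonneg (√a - √b), Real.sq_sqrt ha, Real.sq_sqrt hb]
  have h4 : |√a - √b| * |√a + √b| ≤ |√a - √b| ^ 2 / (2 * δ) + δ * |√a + √b| ^ 2 / 2 := by
    have := sq_nonneg (|√a - √b| - δ * |√a + √b|)
    rw [div_add_div _ _ (by positivity) two_ne_zero, le_div_iff₀ (by positivity)]
    nlinarith
  rw [h1, abs_mul, h2]
  rw [sq_abs, sq_abs] at h4
  nlinarith

/-- The increment equals ν(ρ_V (log ρ_V - log ρ_U)), to which `two_mul_sub_le_mul_log_sub` applies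
pointwise. Both densities have ν-integral 1, so the integrals of ρ_V + ρ_U and 2ρ_V coincide and the
squared Hellinger distance appears. -/
theorem integral_hellinger_le_spinEntropy_sub
    (hac : ∀ V : Finset L,
      (μ : Measure (L → S)).map V.restrict ≪ (ν : Measure (L → S)).map V.restrict)
    (hUV : U ⊆ V) :
    ∫ σ, (spinDensity μ ν V σ + spinDensity μ ν U σ -
        2 * (√(spinDensity μ ν V σ) * √(spinDensity μ ν U σ))) ∂(ν : Measure (L → S)) ≤
      spinEntropy μ ν V - spinEntropy μ ν U := by
  have lV := isLocal_spinDensity μ ν V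
  have lU := isLocal_spinDensity μ ν U
  have ls := ((lV.comp_left Real.sqrt).mul (lU.comp_left Real.sqrt)).comp_left (2 * ·)
  have llog := lV.mul ((lV.comp_left Real.log).add (lU.comp_left Real.log |>.neg))
  have h1 : spinEntropy μ ν V - spinEntropy μ ν U =
      ∫ σ, spinDensity μ ν V σ * (Real.log (spinDensity μ ν V σ) +
        -Real.log (spinDensity μ ν U σ)) ∂(ν : Measure (L → S)) := by
    rw [spinEntropy, spinEntropy, ← integral_sub ((lV.comp_left Real.log).integrable _)
      ((lU.comp_left Real.log).integrable _), integral_eq_integral_mul_spinDensity (hac V)]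
    · exact integral_congr_ae (Eventually.of_forall fun σ => by ring)
    · exact fun σ τ h => by
        simp only [dependsOn_spinDensity μ ν V h, dependsOn_spinDensity μ ν U fun x hx => h x (hUV hx)]
  have h2 : ∫ σ, (spinDensity μ ν V σ + spinDensity μ ν U σ -
        2 * (√(spinDensity μ ν V σ) * √(spinDensity μ ν U σ))) ∂(ν : Measure (L → S)) =
      ∫ σ, (2 * spinDensity μ ν V σ -
        2 * (√(spinDensity μ ν V σ) * √(spinDensity μ ν U σ))) ∂(ν : Measure (L → S)) := by
    rw [integral_sub ((lV.add lU).integrable _) (ls.integrable _),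
      integral_sub ((lV.comp_left (2 * ·)).integrable _) (ls.integrable _),
      integral_add (lV.integrable _) (lU.integrable _), integral_const_mul,
      integral_const_mul, integral_spinDensity (hac V), integral_spinDensity (hac U)]
    ring
  rw [h1, h2]
  refine integral_mono (((lV.comp_left (2 * ·)).integrable _).sub (ls.integrable _))
    (llog.integrable _) fun σ => ?_
  exact two_mul_sub_le_mul_log_sub (spinDensity_nonneg μ ν V σ) (spinDensity_nonneg μ ν U σ)
    (spinDensity_eq_zero (hac U) hUV)

/-- If passing from `U` to `V ⊇ U` costs little entropy, then `μ` on the spins in `V` is close to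
the measure with density `spinDensity μ ν U`. -/
theorem abs_integral_sub_integral_mul_spinDensity_le
    (hac : ∀ V : Finset L,
      (μ : Measure (L → S)).map V.restrict ≪ (ν : Measure (L → S)).map V.restrict)
    (hUV : U ⊆ V) {δ : ℝ} (hδ : 0 < δ) (h : spinEntropy μ ν V - spinEntropy μ ν U ≤ δ ^ 2)
    {F : (L → S) → ℝ} (hF : DependsOn F (V : Set L)) {M : ℝ} (hM : ∀ σ, |F σ| ≤ M) :
    |∫ σ, F σ ∂(μ : Measure (L → S)) -
      ∫ σ, F σ * spinDensity μ ν U σ ∂(ν : Measure (L → S))| ≤ M * (3 * δ) := by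
  have lV := isLocal_spinDensity μ ν V
  have lU := isLocal_spinDensity μ ν U
  have lF : IsLocal F := ⟨V, hF⟩
  have ls := ((lV.comp_left Real.sqrt).mul (lU.comp_left Real.sqrt)).comp_left (2 * ·)
  have iH : Integrable (fun σ => (spinDensity μ ν V σ + spinDensity μ ν U σ -
      2 * (√(spinDensity μ ν V σ) * √(spinDensity μ ν U σ))) / (2 * δ)) (ν : Measure (L → S)) :=
    (((lV.add lU).integrable (ν : Measure (L → S))).sub (ls.integrable _)).div_const (2 * δ)
  have iA := ((lV.add lU).integrable (ν : Measure (L → S))).const_mul δ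
  have hM0 : 0 ≤ M := (abs_nonneg _).trans (hM (Classical.choice (ν.nonempty)))
  rw [integral_eq_integral_mul_spinDensity (hac V) hF,
    ← integral_sub ((lF.mul lV).integrable _) ((lF.mul lU).integrable _)]
  calc _ ≤ ∫ σ, M * ((spinDensity μ ν V σ + spinDensity μ ν U σ -
        2 * (√(spinDensity μ ν V σ) * √(spinDensity μ ν U σ))) / (2 * δ) +
        δ * (spinDensity μ ν V σ + spinDensity μ ν U σ)) ∂(ν : Measure (L → S)) := by
        rw [← Real.norm_eq_abs]
        refine norm_integral_le_of_norm_le ((iH.add iA).const_mul M)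
          (Eventually.of_forall fun σ => ?_)
        rw [← mul_sub, Real.norm_eq_abs, abs_mul]
        exact mul_le_mul (hM σ) (abs_sub_le_sqrt_sub_sq (spinDensity_nonneg μ ν V σ)
          (spinDensity_nonneg μ ν U σ) hδ) (abs_nonneg _) hM0
    _ ≤ M * (3 * δ) := by
        rw [integral_const_mul]
        refine mul_le_mul_of_nonneg_left ?_ hM0
        rw [integral_add iH iA, integral_div, integral_const_mul,
          integral_add (lV.integrable _) (lU.integrable _), integral_spinDensity (hac V),
          integral_spinDensity (hac U)]
        have h1 := (integral_hellinger_le_spinEntropy_sub hac hUV).trans h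
        -- The Hellinger term is at most δ²/(2δ) ≤ δ, and the other term is 2δ because each density
        -- has mass 1: together 3δ.
        have h2 : (∫ σ, (spinDensity μ ν V σ + spinDensity μ ν U σ -
            2 * (√(spinDensity μ ν V σ) * √(spinDensity μ ν U σ))) ∂(ν : Measure (L → S))) /
            (2 * δ) ≤ δ := by
          rw [div_le_iff₀ (by positivity)]
          nlinarith
        refine (add_le_add_left h2 _).trans_eq (by ring)

/-- On a finite space the Radon–Nikodym derivative at a point of positive ν-mass is the quotient of
the masses, and by absolute continuity μ-almost every point is of that kind. -/
theorem toReal_relEntropy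
    (hac : (μ : Measure (L → S)).map V.restrict ≪ (ν : Measure (L → S)).map V.restrict) :
    (relEntropy V μ ν).toReal = spinEntropy μ ν V := by
  have : IsProbabilityMeasure ((μ : Measure (L → S)).map V.restrict) :=
    Measure.isProbabilityMeasure_map (Finset.measurable_restrict V).aemeasurable
  have : IsProbabilityMeasure ((ν : Measure (L → S)).map V.restrict) :=
    Measure.isProbabilityMeasure_map (Finset.measurable_restrict V).aemeasurable
  rw [relEntropy, InformationTheory.toReal_klDiv_of_measure_eq hac (by simp),
    integral_map (Finset.measurable_restrict V).aemeasurable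
      (measurable_of_finite _).aestronglyMeasurable, spinEntropy]
  have key : ∀ ξ : V → S, ((ν : Measure (L → S)).map V.restrict).real {ξ} ≠ 0 →
      (((μ : Measure (L → S)).map V.restrict).rnDeriv
        ((ν : Measure (L → S)).map V.restrict) ξ).toReal =
      ((μ : Measure (L → S)).map V.restrict).real {ξ} /
        ((ν : Measure (L → S)).map V.restrict).real {ξ} := by
    intro ξ hξ
    have := Measure.setLIntegral_rnDeriv hac {ξ}
    rw [lintegral_singleton] at this
    rw [eq_div_iff hξ, Measure.real, Measure.real, ← ENNReal.toReal_mul, this]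
  have hae : ∀ᵐ σ ∂(μ : Measure (L → S)),
      ((ν : Measure (L → S)).map V.restrict).real {(V.restrict σ : V → S)} ≠ 0 := by
    have h1 : ∀ᵐ ξ ∂((μ : Measure (L → S)).map V.restrict),
        ((ν : Measure (L → S)).map V.restrict).real {ξ} ≠ 0 := by
      rw [ae_iff_of_countable]
      intro ξ hξ h0
      exact hξ (hac ((measureReal_eq_zero_iff).1 h0))
    exact ae_of_ae_map (Finset.measurable_restrict V).aemeasurable h1
  refine integral_congr_ae ?_
  filter_upwards [hae] with σ hσ
  rw [llr, key _ hσ, measureReal_map_restrict_singleton, measureReal_map_restrict_singleton]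
  rfl

theorem spinEntropy_nonneg
    (hac : (μ : Measure (L → S)).map V.restrict ≪ (ν : Measure (L → S)).map V.restrict) :
    0 ≤ spinEntropy μ ν V :=
  toReal_relEntropy hac ▸ ENNReal.toReal_nonneg

end Density

/-! ### Translation invariance of the entropy and superadditivity -/

section Translation

variable {L S : Type*} {d : ℕ} [AddAction (Fin d → ℤ) L]

theorem shift_mono (i : Fin d → ℤ) {V W : Finset L} (h : V ⊆ W) : shift i V ⊆ shift i W :=
  Finset.map_subset_map.2 h

theorem translateConfig_mem_spinsEq_shift (i : Fin d → ℤ) (V : Finset L) (σ τ : L → S) :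
    translateConfig i τ ∈ spinsEq (shift i V) (translateConfig i σ) ↔ τ ∈ spinsEq V σ := by
  refine ⟨fun h x hx => ?_, fun h x hx => h _ (mem_shift.1 hx)⟩
  have := h (i +ᵥ x) (by rw [mem_shift]; simpa using hx)
  simpa [translateConfig] using this

variable [MeasurableSpace S] [MeasurableSingletonClass S] {μ ν : ProbabilityMeasure (L → S)}

theorem IsInvariantMeasure.measureReal_spinsEq_shift (hμ : IsInvariantMeasure d μ) (i : Fin d → ℤ)
    (V : Finset L) (σ : L → S) :
    (μ : Measure (L → S)).real (spinsEq (shift i V) (translateConfig i σ)) =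
      (μ : Measure (L → S)).real (spinsEq V σ) := by
  conv_lhs => rw [← hμ i]
  rw [map_measureReal_apply (measurable_translateConfig i) (measurableSet_spinsEq _ _)]
  congr 1
  ext τ
  exact translateConfig_mem_spinsEq_shift i V σ τ

variable [Finite S]

theorem spinEntropy_shift (hμ : IsInvariantMeasure d μ) (hν : IsInvariantMeasure d ν)
    (i : Fin d → ℤ) (V : Finset L) : spinEntropy μ ν (shift i V) = spinEntropy μ ν V := by
  unfold spinEntropy
  conv_lhs => rw [← hμ i]
  rw [integral_map (measurable_translateConfig i).aemeasurable
    ((isLocal_spinDensity μ ν _).comp_left Real.log).measurable.aestronglyMeasurable]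
  simp only [spinDensity, hμ.measureReal_spinsEq_shift, hν.measureReal_spinsEq_shift]

/-- Disjoint translates of a window in which `Λ` carries conditional entropy at least `ε`
contribute additively to the entropy. -/
theorem card_mul_le_spinEntropy [DecidableEq L] (hμ : IsInvariantMeasure d μ)
    (hν : IsInvariantMeasure d ν)
    (hac : ∀ V : Finset L,
      (μ : Measure (L → S)).map V.restrict ≪ (ν : Measure (L → S)).map V.restrict)
    {Λ W : Finset L} (hΛ : Λ ⊆ W) {ε : ℝ}
    (hε : ∀ V, W ⊆ V → ε ≤ spinEntropy μ ν V - spinEntropy μ ν (V \ Λ))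
    (J : Finset (Fin d → ℤ)) : ∀ V : Finset L, (∀ j ∈ J, shift j W ⊆ V) →
      ((J : Set (Fin d → ℤ)).PairwiseDisjoint fun j => shift j W) →
      J.card * ε ≤ spinEntropy μ ν V := by
  induction J using Finset.induction_on with
  | empty => exact fun V _ _ => by simpa using spinEntropy_nonneg (hac V)
  | insert j J hj ih =>
    intro V hV hd
    -- Moving the jth window back to W shows that deleting τ_jΛ from V costs at least ε of entropy.
    -- The other windows are disjoint from the jth, hence survive the deletion, and induction goes
    -- on.
    have h1 := hε (shift (-j) V) (by
      rw [← shift_neg_shift j W]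
      exact shift_mono _ (hV j (Finset.mem_insert_self _ _)))
    have h2 : shift (-j) V \ Λ = shift (-j) (V \ shift j Λ) := by
      ext x
      simp
    rw [h2, spinEntropy_shift hμ hν, spinEntropy_shift hμ hν] at h1
    have h3 := ih (V \ shift j Λ) (fun k hk x hx => ?_)
      (hd.subset (by simp))
    · rw [Finset.card_insert_of_notMem hj]
      push_cast
      linarith
    · refine Finset.mem_sdiff.2 ⟨hV k (Finset.mem_insert_of_mem hk) hx, fun hx' => ?_⟩
      have hne : k ≠ j := fun h => hj (h ▸ hk)
      exact Finset.disjoint_left.1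
        (hd (Finset.mem_insert_of_mem hk) (Finset.mem_insert_self _ _) hne) hx (shift_mono j hΛ hx')

end Translation

/-! ### Packing cubes by translates of a smaller cube -/

section Packing

variable {L : Type*} {d : ℕ} [AddAction (Fin d → ℤ) L]

theorem mem_cube {o x : L} {n : ℕ} :
    x ∈ cube d o n ↔ ∃ i : Fin d → ℤ, (∀ k, |i k| ≤ n) ∧ i +ᵥ o = x := by
  classical
  simp only [cube, Finset.mem_image, Finset.mem_Icc, Pi.le_def]
  constructor
  · rintro ⟨i, ⟨h1, h2⟩, rfl⟩
    exact ⟨-i, fun k => by rw [Pi.neg_apply, abs_neg]; exact abs_le.2 ⟨h1 k, h2 k⟩, rfl⟩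
  · rintro ⟨i, h, rfl⟩
    exact ⟨-i, ⟨fun k => neg_le_neg (abs_le.1 (h k)).2, fun k => neg_le.1 (abs_le.1 (h k)).1⟩, by
      rw [neg_neg]⟩

theorem cube_nonempty (o : L) (n : ℕ) : (cube d o n).Nonempty :=
  ⟨o, mem_cube.2 ⟨0, fun k => by simp, by simp⟩⟩

theorem cube_mono (o : L) {m n : ℕ} (h : m ≤ n) : cube d o m ⊆ cube d o n := by
  intro x hx
  obtain ⟨i, hi, rfl⟩ := mem_cube.1 hx
  exact mem_cube.2 ⟨i, fun k => (hi k).trans (by exact_mod_cast h), rfl⟩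

theorem exists_subset_cube [AddAction.IsPretransitive (Fin d → ℤ) L] (o : L) (W : Finset L) :
    ∃ m, W ⊆ cube d o m := by
  classical
  induction W using Finset.induction_on with
  | empty => exact ⟨0, by simp⟩
  | insert x W _ ih =>
    obtain ⟨m, hm⟩ := ih
    obtain ⟨i, rfl⟩ := AddAction.exists_vadd_eq (Fin d → ℤ) o x
    let n := ∑ k, (i k).natAbs
    have hn : i +ᵥ o ∈ cube d o n := mem_cube.2 ⟨i, fun k => by
      rw [Int.abs_eq_natAbs]
      exact_mod_cast Finset.single_le_sum (f := fun k => (i k).natAbs) (fun _ _ => Nat.zero_le _)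
        (Finset.mem_univ k), rfl⟩
    refine ⟨max m n, Finset.insert_subset (cube_mono o (le_max_right _ _) hn)
      (hm.trans (cube_mono o (le_max_left _ _)))⟩

/-- A maximal packing of a large cube by translates of a small one has positive density. -/
theorem exists_packing (o : L) {m n : ℕ} (hmn : m ≤ n) : ∃ J : Finset (Fin d → ℤ),
    (∀ j ∈ J, shift j (cube d o m) ⊆ cube d o n) ∧
    ((J : Set (Fin d → ℤ)).PairwiseDisjoint fun j => shift j (cube d o m)) ∧
    (cube d o n).card ≤ J.card * (cube d o (3 * m)).card := by
  classical
  -- Translations by at most n - m in each coordinate keep the small cube inside the large one.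
  let B : Finset (Fin d → ℤ) :=
    Finset.Icc (fun _ => -((n - m : ℕ) : ℤ)) (fun _ => ((n - m : ℕ) : ℤ))
  have hB : ∀ j, j ∈ B ↔ ∀ k, |j k| ≤ ((n - m : ℕ) : ℤ) := fun j => by
    simp only [B, Finset.mem_Icc, Pi.le_def, abs_le, forall_and]
  let F : Finset (Finset (Fin d → ℤ)) := B.powerset.filter fun J =>
    (J : Set (Fin d → ℤ)).PairwiseDisjoint fun j => shift j (cube d o m)
  obtain ⟨J, hJF, hJmax⟩ := F.exists_max_image Finset.card
    ⟨∅, by simp [F]⟩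
  obtain ⟨hJB, hJd⟩ := Finset.mem_filter.1 hJF
  rw [Finset.mem_powerset] at hJB
  refine ⟨J, fun j hj x hx => ?_, hJd, ?_⟩
  · rw [mem_shift] at hx
    obtain ⟨a, ha, hax⟩ := mem_cube.1 hx
    refine mem_cube.2 ⟨j + a, fun k => ?_, by rw [add_vadd, hax, vadd_vadd]; simp⟩
    have h1 := (hB j).1 (hJB hj) k
    have h2 := ha k
    rw [Pi.add_apply]
    refine (abs_add_le _ _).trans ?_
    omega
  -- By maximality the translate by i meets a chosen one, so the two differ by at most 2m. The
  -- action need not be free, so only the points i + o and (j + c) + o are identified.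
  · have key : ∀ i ∈ B, ∃ j ∈ J, ∃ c : Fin d → ℤ, (∀ k, |c k| ≤ 2 * m) ∧
        i +ᵥ o = (j + c) +ᵥ o := by
      intro i hi
      by_contra! hcon
      have hiJ : i ∉ J := fun h => hcon i h 0 (fun k => by simp) (by simp)
      have hins : insert i J ∈ F := by
        refine Finset.mem_filter.2 ⟨Finset.mem_powerset.2 (Finset.insert_subset hi hJB), ?_⟩
        rw [Finset.coe_insert]
        refine hJd.insert fun j hj _ => Finset.disjoint_left.2 fun x hx hx' => ?_
        rw [mem_shift] at hx hx'
        obtain ⟨a, ha, hax⟩ := mem_cube.1 hx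
        obtain ⟨b, hb, hbx⟩ := mem_cube.1 hx'
        refine hcon j hj (b - a) (fun k => ?_) ?_
        · rw [Pi.sub_apply]
          refine (abs_sub _ _).trans ?_
          have := ha k
          have := hb k
          omega
        · have e1 : x = (i + a) +ᵥ o := by rw [add_vadd, hax, vadd_vadd]; simp
          have e2 : x = (j + b) +ᵥ o := by rw [add_vadd, hbx, vadd_vadd]; simp
          have e3 : i = -a + (i + a) := by abel
          have e4 : j + (b - a) = -a + (j + b) := by abel
          rw [e3, e4, add_vadd, ← e1, add_vadd, ← e2]
      have := hJmax _ hins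
      rw [Finset.card_insert_of_notMem hiJ] at this
      omega
    have hcover : cube d o n ⊆ J.biUnion fun j => shift j (cube d o (3 * m)) := by
      intro x hx
      obtain ⟨i, hi, rfl⟩ := mem_cube.1 hx
      -- Clamping i into `B` moves each coordinate by at most m; with the 2m of `key` this accounts
      -- for the radius 3m.
      let i' : Fin d → ℤ := fun k => max (-((n - m : ℕ) : ℤ)) (min ((n - m : ℕ) : ℤ) (i k))
      obtain ⟨j, hj, c, hc, hjc⟩ := key i' ((hB i').2 fun k => by
        simp only [i', abs_le]
        omega)
      refine Finset.mem_biUnion.2 ⟨j, hj, ?_⟩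
      rw [mem_shift, mem_cube]
      refine ⟨c + (i - i'), fun k => ?_, ?_⟩
      · have h1 := hc k
        have h2 := hi k
        simp only [i', Pi.add_apply, Pi.sub_apply]
        rw [abs_le] at *
        push_cast
        omega
      · have e2 : c + (i - i') = -j + ((i - i') + (j + c)) := by abel
        rw [e2, add_vadd (-j), add_vadd (i - i'), ← hjc, ← add_vadd (i - i'), sub_add_cancel]
    refine (Finset.card_le_card hcover).trans ?_
    refine Finset.card_biUnion_le_card_mul _ _ _ fun j _ => ?_
    rw [shift, Finset.card_map]

end Packing

/-! ### Zero entropy density yields small conditional entropy -/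

section Increment

variable {L S : Type*} [MeasurableSpace S] {d : ℕ} [AddAction (Fin d → ℤ) L] {o : L}
  {μ ν : ProbabilityMeasure (L → S)}

theorem HasRelEntropyDensity.eventually_lt (h : HasRelEntropyDensity d o μ ν 0) {ε : ℝ}
    (hε : 0 < ε) : ∀ᶠ n : ℕ in atTop, relEntropy (cube d o n) μ ν ≠ ⊤ ∧
      (relEntropy (cube d o n) μ ν).toReal < ε * (cube d o n).card := by
  have h1 := h.eventually_lt_const (ENNReal.ofReal_pos.2 hε)
  filter_upwards [h1] with n hn
  have hc : ((cube d o n).card : ℝ≥0∞) ≠ 0 := by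
    exact_mod_cast (Finset.card_pos.2 (cube_nonempty o n)).ne'
  rw [ENNReal.div_lt_iff (Or.inl hc) (Or.inl (ENNReal.natCast_ne_top _))] at hn
  have htop : ENNReal.ofReal ε * ((cube d o n).card : ℝ≥0∞) ≠ ⊤ :=
    ENNReal.mul_ne_top ENNReal.ofReal_ne_top (ENNReal.natCast_ne_top _)
  refine ⟨hn.ne_top, ?_⟩
  have := (ENNReal.toReal_lt_toReal hn.ne_top htop).2 hn
  rwa [ENNReal.toReal_mul, ENNReal.toReal_ofReal hε.le, ENNReal.toReal_natCast] at this

variable [AddAction.IsPretransitive (Fin d → ℤ) L]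

/-- A limit equal to 0 forces finite entropy on all large cubes, and these absorb any finite set by
transitivity. -/
theorem HasRelEntropyDensity.absolutelyContinuous (h : HasRelEntropyDensity d o μ ν 0)
    (V : Finset L) :
    (μ : Measure (L → S)).map V.restrict ≪ (ν : Measure (L → S)).map V.restrict := by
  obtain ⟨m, hm⟩ := exists_subset_cube (d := d) o V
  obtain ⟨n, hn, hmn⟩ := ((h.eventually_lt one_pos).and (eventually_ge_atTop m)).exists
  exact ac_of_relEntropy_ne_top hn.1 (hm.trans (cube_mono o hmn))

/-- If the relative entropy density vanishes, then the conditional entropy in `Λ` given the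
remaining spins of some arbitrarily large window is arbitrarily small. -/
theorem HasRelEntropyDensity.exists_spinEntropy_sub_lt [MeasurableSingletonClass S] [Finite S]
    [DecidableEq L]
    (h : HasRelEntropyDensity d o μ ν 0)
    (hμ : IsInvariantMeasure d μ) (hν : IsInvariantMeasure d ν) (Λ W : Finset L) {ε : ℝ}
    (hε : 0 < ε) :
    ∃ V, W ⊆ V ∧ Λ ⊆ V ∧ spinEntropy μ ν V - spinEntropy μ ν (V \ Λ) < ε := by
  by_contra! hcon
  obtain ⟨m, hm⟩ := exists_subset_cube (d := d) o (W ∪ Λ)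
  have hW : W ⊆ cube d o m := Finset.union_subset_left hm
  have hΛ : Λ ⊆ cube d o m := Finset.union_subset_right hm
  have hK : 0 < ((cube d o (3 * m)).card : ℝ) := by
    exact_mod_cast Finset.card_pos.2 (cube_nonempty o _)
  -- The packing has at least |Λ_n| / |Λ_{3m}| members, each worth ε, so an entropy below (ε /
  -- |Λ_{3m}|) |Λ_n| is contradictory.
  obtain ⟨n, hn, hmn⟩ := ((h.eventually_lt (div_pos hε hK)).and (eventually_ge_atTop m)).exists
  obtain ⟨J, hJ, hJd, hcard⟩ := exists_packing (d := d) o hmn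
  have h1 := card_mul_le_spinEntropy hμ hν h.absolutelyContinuous hΛ
    (fun V hV => hcon V (hW.trans hV) (hΛ.trans hV)) J _ hJ hJd
  rw [toReal_relEntropy (h.absolutelyContinuous _)] at hn
  have h2 : ((cube d o n).card : ℝ) ≤ J.card * (cube d o (3 * m)).card := by exact_mod_cast hcard
  have h3 : ε / (cube d o (3 * m)).card * (cube d o n).card ≤ J.card * ε := by
    rw [div_mul_eq_mul_div, div_le_iff₀ hK]
    nlinarith
  linarith [hn.2]

end Increment

/-! ### Integrals against finite-volume densities -/

section Decomposition

theorem abs_spinDensity_mul_kernelApply_le {L S : Type*} [Finite S] [MeasurableSpace S]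
    (μ ν : ProbabilityMeasure (L → S)) (U : Finset L) :
    ∃ C, ∀ (γ : KernelFamily L S) (Λ : Finset L) (f : (L → S) → ℝ) (M : ℝ), (∀ σ, |f σ| ≤ M) →
      ∀ ω σ, |spinDensity μ ν U σ * kernelApply γ Λ f ω| ≤ C * M := by
  obtain ⟨C, hC, hCb⟩ := (isLocal_spinDensity μ ν U).exists_bound
  refine ⟨C, fun γ Λ f M hM ω σ => ?_⟩
  rw [abs_mul]
  exact mul_le_mul (hCb σ) (abs_kernelApply_le hM Λ ω) (abs_nonneg _) hC.le

variable {L S : Type*}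

theorem indicator_spinsEq_mul {U : Finset L} {F : (L → S) → ℝ} (hF : DependsOn F (U : Set L))
    (ξ σ : L → S) : (spinsEq U ξ).indicator (fun _ => (1 : ℝ)) σ * F σ =
      (spinsEq U ξ).indicator (fun _ => (1 : ℝ)) σ * F ξ := by
  by_cases h : σ ∈ spinsEq U ξ
  · rw [hF fun x hx => h x hx]
  · simp [h]

variable [MeasurableSpace S] [MeasurableSingletonClass S] [Finite S]

theorem integral_eq_sum_spinsEq (P : ProbabilityMeasure (L → S)) (U : Finset L)
    [Fintype (U → S)] [DecidableEq L] (θ : L → S) {F : (L → S) → ℝ} (hF : IsLocal F) :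
    ∫ σ, F σ ∂(P : Measure (L → S)) = ∑ ξ : U → S, ∫ σ,
      (spinsEq U (Function.updateFinset θ U ξ)).indicator (fun _ => 1) σ * F σ
        ∂(P : Measure (L → S)) := by
  rw [← integral_finsetSum _ fun ξ _ => ((isLocal_indicator_spinsEq U _).mul hF).integrable _]
  refine integral_congr_ae (Eventually.of_forall fun σ => ?_)
  have hmem : ∀ ξ : U → S, σ ∈ spinsEq U (Function.updateFinset θ U ξ) ↔ ξ = U.restrict σ := by
    intro ξ
    simp only [spinsEq, Set.mem_ofPred_eq, Function.updateFinset, funext_iff, Subtype.forall,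
      Finset.restrict]
    exact forall₂_congr fun x hx => by simp [hx, eq_comm]
  simp only
  rw [Finset.sum_eq_single (U.restrict σ)]
  · rw [Set.indicator_of_mem ((hmem _).2 rfl), one_mul]
  · intro ξ _ hξ
    rw [Set.indicator_of_notMem (mt (hmem ξ).1 hξ), zero_mul]
  · simp

theorem kernelApply_eq_of_spinsEq {γ γ' : KernelFamily L S} {Λ : Finset L} {ω : L → S}
    (h : ∀ (V : Finset L) (ξ : L → S),
      kernelApply γ Λ ((spinsEq V ξ).indicator fun _ => 1) ω =
        kernelApply γ' Λ ((spinsEq V ξ).indicator fun _ => 1) ω)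
    {f : (L → S) → ℝ} (hf : IsLocal f) : kernelApply γ Λ f ω = kernelApply γ' Λ f ω := by
  classical
  have hf' := hf
  obtain ⟨V, hV⟩ := hf
  have := Fintype.ofFinite (V → S)
  unfold kernelApply at h ⊢
  rw [integral_eq_sum_spinsEq _ V ω hf', integral_eq_sum_spinsEq _ V ω hf']
  refine Finset.sum_congr rfl fun ξ _ => ?_
  generalize Function.updateFinset ω V ξ = ζ
  have key : ∀ P : Measure (L → S), ∫ σ, (spinsEq V ζ).indicator (fun _ => 1) σ * f σ ∂P =
      (∫ σ, (spinsEq V ζ).indicator (fun _ => 1) σ ∂P) * f ζ := fun P => by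
    rw [← integral_mul_const]
    exact integral_congr_ae (Eventually.of_forall fun σ => indicator_spinsEq_mul hV ζ σ)
  rw [key, key, h]

theorem ae_eq_of_measure_agreementSet {γ γ' : KernelFamily L S} (hγ : IsSpecification γ)
    (hγ' : IsSpecification γ') {μ : ProbabilityMeasure (L → S)}
    (h : (μ : Measure (L → S)) (agreementSet γ γ') = 1) (Λ : Finset L) {f : (L → S) → ℝ}
    (hf : IsLocal f) :
    ∀ᵐ ω ∂(μ : Measure (L → S)), kernelApply γ Λ f ω = kernelApply γ' Λ f ω := by
  have hm : MeasurableSet {ω | kernelApply γ Λ f ω = kernelApply γ' Λ f ω} :=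
    measurableSet_eq_fun (hγ.measurable_kernelApply' Λ hf.measurable)
      (hγ'.measurable_kernelApply' Λ hf.measurable)
  refine (prob_compl_eq_zero_iff hm).2 (le_antisymm prob_le_one (h ▸ measure_mono fun ω hω => ?_))
  exact hω Λ f hf

theorem integral_eq_integral_spinDensity_mul {d : ℕ} [AddAction (Fin d → ℤ) L]
    [AddAction.IsPretransitive (Fin d → ℤ) L] {o : L} {μ ν : ProbabilityMeasure (L → S)}
    (h : HasRelEntropyDensity d o μ ν 0) {D : Set L} {U : Finset L} (hU : D ⊆ U)
    {F : (L → S) → ℝ} (hF : DependsOn F D) :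
    ∫ σ, F σ ∂(μ : Measure (L → S)) =
      ∫ σ, spinDensity μ ν U σ * F σ ∂(ν : Measure (L → S)) := by
  rw [integral_eq_integral_mul_spinDensity (h.absolutelyContinuous U) (hF.mono hU)]
  simp only [mul_comm]

/-- The density on U does not see the spins in Λ, so it passes inside γ_Λ, and the DLR equation of ν
removes the kernel. -/
theorem integral_spinDensity_mul_kernelApply [Countable L] {γ : KernelFamily L S} (hγ : IsSpecification γ)
    {μ ν : ProbabilityMeasure (L → S)} (hν : IsConsistentWith ν γ) {U Λ : Finset L}
    (hU : Disjoint U Λ) {f : (L → S) → ℝ} (hf : IsLocal f) :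
    ∫ σ, spinDensity μ ν U σ * kernelApply γ Λ f σ ∂(ν : Measure (L → S)) =
      ∫ σ, spinDensity μ ν U σ * f σ ∂(ν : Measure (L → S)) := by
  have hloc := (isLocal_spinDensity μ ν U).mul hf
  obtain ⟨M, -, hM⟩ := hloc.exists_bound
  rw [← hν.integral_kernelApply hγ Λ hloc.measurable hM]
  refine integral_congr_ae (Eventually.of_forall fun σ => ?_)
  exact (hγ.kernelApply_mul σ ((dependsOn_spinDensity μ ν U).mono fun x hx =>
    by simpa using Finset.disjoint_left.1 hU hx) f).symm

/-- If the relative entropy density with respect to a Gibbs measure `ν` vanishes, then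
`μ(f)` is approximated by the integrals of `γ_Λ f` against densities of `μ` with respect to `ν`
on large sets of spins. -/
theorem HasRelEntropyDensity.exists_abs_integral_sub_le [Countable L] [DecidableEq L]
    {d : ℕ} [AddAction (Fin d → ℤ) L] [AddAction.IsPretransitive (Fin d → ℤ) L] {o : L}
    {γ : KernelFamily L S} {μ ν : ProbabilityMeasure (L → S)}
    (h : HasRelEntropyDensity d o μ ν 0) (hμ : IsInvariantMeasure d μ)
    (hν : IsInvariantMeasure d ν) (hγ : IsSpecification γ) (hνγ : IsConsistentWith ν γ)
    (Λ W : Finset L) {f : (L → S) → ℝ} (hf : IsLocal f) {ε : ℝ} (hε : 0 < ε) :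
    ∃ U, W \ Λ ⊆ U ∧ |∫ σ, f σ ∂(μ : Measure (L → S)) -
      ∫ σ, spinDensity μ ν U σ * kernelApply γ Λ f σ ∂(ν : Measure (L → S))| ≤ ε := by
  obtain ⟨M, hM0, hM⟩ := hf.exists_bound
  have hf' := hf
  obtain ⟨Δ, hΔ⟩ := hf
  -- Chosen so that the error M · 3δ is exactly ε.
  have hδ : 0 < ε / (3 * M) := by positivity
  obtain ⟨V, hWV, -, hV⟩ := h.exists_spinEntropy_sub_lt hμ hν Λ (W ∪ Δ)
    (pow_pos hδ 2)
  refine ⟨V \ Λ, Finset.sdiff_subset_sdiff (Finset.union_subset_left hWV) le_rfl, ?_⟩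
  have h1 := abs_integral_sub_integral_mul_spinDensity_le h.absolutelyContinuous
    (Finset.sdiff_subset : V \ Λ ⊆ V) hδ hV.le
    (hΔ.mono (Finset.coe_subset.2 (Finset.union_subset_right hWV))) hM
  rw [integral_spinDensity_mul_kernelApply hγ hνγ Finset.sdiff_disjoint hf']
  simp only [mul_comm (f _)] at h1
  refine h1.trans_eq ?_
  field_simp

end Decomposition

/-! ### The variational principle -/

section Variational

variable {L S : Type*} [Countable L] [Finite S] [LinearOrder S] [TopologicalSpace S]
  [DiscreteTopology S] [MeasurableSpace S] [BorelSpace S] {γ : KernelFamily L S} {θ η : L → S}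

/-- The null set depends on the function, so agreement is first imposed on the countably many
cylinder indicators; every local function is a finite linear combination of these. -/
theorem measure_agreementSet_eq_one {γ γ' : KernelFamily L S} {μ : ProbabilityMeasure (L → S)}
    (h : ∀ (Λ : Finset L) (f : (L → S) → ℝ), IsLocal f → Monotone f →
      ∀ᵐ ω ∂(μ : Measure (L → S)), kernelApply γ Λ f ω = kernelApply γ' Λ f ω) :
    (μ : Measure (L → S)) (agreementSet γ γ') = 1 := by
  classical
  obtain ⟨ω₀⟩ := μ.nonempty
  have hloc : ∀ (Λ : Finset L) (f : (L → S) → ℝ), IsLocal f →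
      ∀ᵐ ω ∂(μ : Measure (L → S)), kernelApply γ Λ f ω = kernelApply γ' Λ f ω := by
    intro Λ f hf
    obtain ⟨a, b, ha, hb, hma, hmb, rfl⟩ := hf.exists_monotone_sub
    filter_upwards [h Λ a ha hma, h Λ b hb hmb] with ω h1 h2
    rw [kernelApply_sub γ Λ ha hb, kernelApply_sub γ' Λ ha hb]
    simp only [h1, h2]
  have hall : ∀ᵐ ω ∂(μ : Measure (L → S)), ∀ (Λ V : Finset L) (ξ : V → S),
      kernelApply γ Λ ((spinsEq V (Function.updateFinset ω₀ V ξ)).indicator fun _ => 1) ω =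
        kernelApply γ' Λ ((spinsEq V (Function.updateFinset ω₀ V ξ)).indicator fun _ => 1) ω := by
    simp only [ae_all_iff]
    exact fun Λ V ξ => hloc Λ _ (isLocal_indicator_spinsEq V _)
  have hA : ∀ᵐ ω ∂(μ : Measure (L → S)), ω ∈ agreementSet γ γ' := by
    filter_upwards [hall] with ω hω Λ f hf
    refine kernelApply_eq_of_spinsEq (fun V ξ => ?_) hf
    have : spinsEq V ξ = spinsEq V (Function.updateFinset ω₀ V (V.restrict ξ)) :=
      Set.ext fun σ => forall₂_congr fun x hx => by simp [Function.updateFinset, hx]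
    rw [this]
    exact hω Λ V _
  exact (measure_congr (eventuallyEq_univ.2 hA)).trans measure_univ

variable {d : ℕ} [AddAction (Fin d → ℤ) L] [AddAction.IsPretransitive (Fin d → ℤ) L] {o : L}
  {μ : ProbabilityMeasure (L → S)}

/-- For fixed W choose U containing W∖Λ. Then μ(f) ≈ ν(ρ_U γ^{(+)}_Λ f) ≤ ν(ρ_U γ_Λ f(σ_W +)) =
μ(γ_Λ f(σ_W +)), the last function depending only on W∖Λ. Let the error vanish, then W grow. -/
theorem le_integral_kernelApply_top (hmono : IsMonotonicityPreserving γ) (hγ : IsSpecification γ)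
    (hinv : IsInvariantFamily d γ) (hθ : IsTop θ) (hμ : IsInvariantMeasure d μ)
    (h : HasRelEntropyDensity d o μ (boundaryLimit γ θ) 0) (Λ : Finset L) {f : (L → S) → ℝ}
    (hf : IsLocal f) (hm : Monotone f) :
    ∫ σ, f σ ∂(μ : Measure (L → S)) ≤
      ∫ σ, kernelApply (directionLimit γ θ) Λ f σ ∂(μ : Measure (L → S)) := by
  classical
  have hγp := isSpecification_directionLimit hmono hγ hθ
  refine ge_of_tendsto (tendsto_integral_kernelApply_glue hmono hθ Λ hf _)
    (Eventually.of_forall fun W => le_of_forall_pos_le_add fun ε hε => ?_)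
  obtain ⟨U, hWU, hU⟩ := h.exists_abs_integral_sub_le hμ
    (isInvariantMeasure_boundaryLimit hmono hγ hinv hθ) hγp
    (isConsistentWith_boundaryLimit hmono hγ hθ) Λ W hf hε
  have hW := integral_eq_integral_spinDensity_mul h (U := U) (by exact_mod_cast hWU)
    (hγ.dependsOn_kernelApply_glue θ Λ W hf.measurable)
  obtain ⟨M, -, hM⟩ := hf.exists_bound
  obtain ⟨C, hC⟩ := abs_spinDensity_mul_kernelApply_le μ (boundaryLimit γ θ) U
  have hle : ∫ σ, spinDensity μ (boundaryLimit γ θ) U σ * kernelApply (directionLimit γ θ) Λ f σ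
      ∂(boundaryLimit γ θ : Measure (L → S)) ≤
      ∫ σ, spinDensity μ (boundaryLimit γ θ) U σ * kernelApply γ Λ f (glue W σ θ)
        ∂(boundaryLimit γ θ : Measure (L → S)) :=
    integral_mono (integrable_of_abs_le ((isLocal_spinDensity _ _ U).measurable.mul
        (hγp.measurable_kernelApply' Λ hf.measurable)) (fun σ => hC _ Λ f M hM σ σ) _)
      (((isLocal_spinDensity _ _ U).mul (isLocal_kernelApply_glue γ θ Λ W f)).integrable _)
      fun σ => mul_le_mul_of_nonneg_left (kernelApply_directionLimit_le hmono hθ Λ W σ hf hm)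
        (spinDensity_nonneg _ _ U σ)
  have := (abs_le.1 hU).2
  linarith

/-- The same approximation by γ^{(+)} is used, now bounded below by γ_Λ f(σ_W -) ≤ γ^{(-)}_Λ f ≤
γ^{(+)}_Λ f. The reference measure remains μ^+, so this is not the order-reversed form of
`le_integral_kernelApply_top`. -/
theorem integral_kernelApply_bot_le (hmono : IsMonotonicityPreserving γ) (hγ : IsSpecification γ)
    (hinv : IsInvariantFamily d γ) (hθ : IsTop θ) (hη : IsBot η) (hμ : IsInvariantMeasure d μ)
    (h : HasRelEntropyDensity d o μ (boundaryLimit γ θ) 0) (Λ : Finset L) {f : (L → S) → ℝ}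
    (hf : IsLocal f) (hm : Monotone f) :
    ∫ σ, kernelApply (directionLimit γ η) Λ f σ ∂(μ : Measure (L → S)) ≤
      ∫ σ, f σ ∂(μ : Measure (L → S)) := by
  classical
  have hγp := isSpecification_directionLimit hmono hγ hθ
  refine le_of_tendsto (@tendsto_integral_kernelApply_glue L S _ (dualLinearOrder S) _ _ _ _ γ η _
    hmono.dual hη Λ f hf _ _)
    (Eventually.of_forall fun W => le_of_forall_pos_le_add fun ε hε => ?_)
  obtain ⟨U, hWU, hU⟩ := h.exists_abs_integral_sub_le hμ
    (isInvariantMeasure_boundaryLimit hmono hγ hinv hθ) hγp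
    (isConsistentWith_boundaryLimit hmono hγ hθ) Λ W hf hε
  have hW := integral_eq_integral_spinDensity_mul h (U := U) (by exact_mod_cast hWU)
    (hγ.dependsOn_kernelApply_glue η Λ W hf.measurable)
  obtain ⟨M, -, hM⟩ := hf.exists_bound
  obtain ⟨C, hC⟩ := abs_spinDensity_mul_kernelApply_le μ (boundaryLimit γ θ) U
  have hle : ∫ σ, spinDensity μ (boundaryLimit γ θ) U σ * kernelApply γ Λ f (glue W σ η)
        ∂(boundaryLimit γ θ : Measure (L → S)) ≤
      ∫ σ, spinDensity μ (boundaryLimit γ θ) U σ * kernelApply (directionLimit γ θ) Λ f σ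
      ∂(boundaryLimit γ θ : Measure (L → S)) :=
    integral_mono
      (((isLocal_spinDensity _ _ U).mul (isLocal_kernelApply_glue γ η Λ W f)).integrable _)
      (integrable_of_abs_le ((isLocal_spinDensity _ _ U).measurable.mul
        (hγp.measurable_kernelApply' Λ hf.measurable)) (fun σ => hC _ Λ f M hM σ σ) _)
      fun σ => mul_le_mul_of_nonneg_left
        ((le_kernelApply_directionLimit hmono hη Λ W σ hf hm).trans
          (kernelApply_bot_le_top hmono hθ hη Λ σ hf hm)) (spinDensity_nonneg _ _ U σ)
  have := (abs_le.1 hU).1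
  linarith

theorem isAlmostQuasilocal_of_agreement (hmono : IsMonotonicityPreserving γ)
    (hγ : IsSpecification γ) (hinv : IsInvariantFamily d γ) (hθ : IsTop θ) (hη : IsBot η)
    (hμ : IsInvariantMeasure d μ) (h : HasRelEntropyDensity d o μ (boundaryLimit γ θ) 0)
    (hA : (μ : Measure (L → S)) (agreementSet (directionLimit γ θ) (directionLimit γ η)) = 1) :
    IsConsistentWith μ (directionLimit γ θ) ∧ IsAlmostQuasilocal μ := by
  have hγp := isSpecification_directionLimit hmono hγ hθ
  have hcons : IsConsistentWith μ (directionLimit γ θ) :=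
    isConsistentWith_of_monotone_local hγp fun Λ f hf hm => by
      refine le_antisymm ?_ (le_integral_kernelApply_top hmono hγ hinv hθ hμ h Λ hf hm)
      refine Eq.trans_le (integral_congr_ae ?_)
        (integral_kernelApply_bot_le hmono hγ hinv hθ hη hμ h Λ hf hm)
      exact ae_eq_of_measure_agreementSet hγp (limitsExist_of_isBot hmono hγ hη).2.1 hA Λ hf
  exact ⟨hcons, _, hγp, hcons, (measure_continuitySet_eq_one hmono hθ hη hA).1⟩

/-- Split over the spin patterns on U. On each atom ρ_U is the ratio of the two masses, and the
inequality is `integral_spinsEq_mul_le` divided by the μ^+-mass. -/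
theorem integral_boundaryLimit_bot_le (hmono : IsMonotonicityPreserving γ)
    (hγ : IsSpecification γ) (hθ : IsTop θ) (hη : IsBot η)
    (h : HasRelEntropyDensity d o (boundaryLimit γ η) (boundaryLimit γ θ) 0) (U : Finset L)
    {g : (L → S) → ℝ} (hg : IsLocal g) (hm : Monotone g) :
    ∫ σ, g σ ∂(boundaryLimit γ η : Measure (L → S)) ≤
      ∫ σ, spinDensity (boundaryLimit γ η) (boundaryLimit γ θ) U σ * g σ
        ∂(boundaryLimit γ θ : Measure (L → S)) := by
  classical
  have := Fintype.ofFinite (U → S)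
  rw [integral_eq_sum_spinsEq _ U θ hg,
    integral_eq_sum_spinsEq _ U θ ((isLocal_spinDensity _ _ U).mul hg)]
  refine Finset.sum_le_sum fun ξ _ => ?_
  generalize Function.updateFinset θ U ξ = ζ
  simp only [← mul_assoc, indicator_spinsEq_mul (dependsOn_spinDensity _ _ U)]
  simp only [mul_right_comm _ (spinDensity _ _ _ _)]
  rw [integral_mul_const, spinDensity]
  have key := integral_spinsEq_mul_le hmono hγ hθ hη U ζ hg hm
  by_cases h0 : (boundaryLimit γ θ : Measure (L → S)).real (spinsEq U ζ) = 0
  -- An atom without μ^+-mass has no μ^--mass either, so both sides vanish there.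
  · have h1 : (boundaryLimit γ η : Measure (L → S)).real (spinsEq U ζ) = 0 := by
      rw [← measureReal_map_restrict_singleton] at h0 ⊢
      have i1 : IsProbabilityMeasure ((boundaryLimit γ η : Measure (L → S)).map U.restrict) :=
        Measure.isProbabilityMeasure_map (Finset.measurable_restrict U).aemeasurable
      have i2 : IsProbabilityMeasure ((boundaryLimit γ θ : Measure (L → S)).map U.restrict) :=
        Measure.isProbabilityMeasure_map (Finset.measurable_restrict U).aemeasurable
      exact measureReal_singleton_of_ac (h.absolutelyContinuous U) h0
    rw [h0, div_zero, mul_zero]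
    refine (integral_eq_zero_of_ae ?_).le
    have h2 : ∀ᵐ σ ∂(boundaryLimit γ η : Measure (L → S)), σ ∉ spinsEq U ζ :=
      measure_eq_zero_iff_ae_notMem.1 ((measureReal_eq_zero_iff).1 h1)
    filter_upwards [h2] with σ hσ
    simp [hσ]
  · have h1 := lt_of_le_of_ne measureReal_nonneg (Ne.symm h0)
    rw [mul_div_assoc', le_div_iff₀ h1]
    exact key

/-- Domination applied to γ_Λ f(σ_W +), with U fixed and W growing, gives μ^-(γ^{(+)}_Λ f) ≤ μ^+(ρ_U
γ^{(+)}_Λ f), which is within ε of μ^-(f) = μ^-(γ^{(-)}_Λ f). Ordered functions whose integrals are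
equal agree almost surely. -/
theorem measure_agreementSet_boundaryLimit_bot (hmono : IsMonotonicityPreserving γ)
    (hγ : IsSpecification γ) (hinv : IsInvariantFamily d γ) (hθ : IsTop θ) (hη : IsBot η)
    (h : HasRelEntropyDensity d o (boundaryLimit γ η) (boundaryLimit γ θ) 0) :
    (boundaryLimit γ η : Measure (L → S))
      (agreementSet (directionLimit γ θ) (directionLimit γ η)) = 1 := by
  classical
  have hγp := isSpecification_directionLimit hmono hγ hθ
  have hγm := (limitsExist_of_isBot hmono hγ hη).2.1
  have hμ : IsInvariantMeasure d (boundaryLimit γ η) :=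
    @isInvariantMeasure_boundaryLimit L S d _ _ (dualLinearOrder S) _ _ _ _ γ η _ hmono.dual hγ
      hinv hη
  refine measure_agreementSet_eq_one fun Λ f hf hm => ?_
  obtain ⟨M, -, hM⟩ := hf.exists_bound
  have hle : ∫ σ, kernelApply (directionLimit γ θ) Λ f σ ∂(boundaryLimit γ η : Measure (L → S)) ≤
      ∫ σ, f σ ∂(boundaryLimit γ η : Measure (L → S)) := by
    refine le_of_forall_pos_le_add fun ε hε => ?_
    obtain ⟨U, -, hU⟩ := h.exists_abs_integral_sub_le hμ
      (isInvariantMeasure_boundaryLimit hmono hγ hinv hθ) hγp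
      (isConsistentWith_boundaryLimit hmono hγ hθ) Λ ∅ hf hε
    obtain ⟨C, hC⟩ :=
      abs_spinDensity_mul_kernelApply_le (boundaryLimit γ η) (boundaryLimit γ θ) U
    have hlim : Tendsto (fun W : Finset L => ∫ σ,
        spinDensity (boundaryLimit γ η) (boundaryLimit γ θ) U σ * kernelApply γ Λ f (glue W σ θ)
          ∂(boundaryLimit γ θ : Measure (L → S))) atTop
        (𝓝 (∫ σ, spinDensity (boundaryLimit γ η) (boundaryLimit γ θ) U σ *
          kernelApply (directionLimit γ θ) Λ f σ ∂(boundaryLimit γ θ : Measure (L → S)))) :=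
      tendsto_integral_filter_of_dominated_convergence (fun _ => C * M)
        (Eventually.of_forall fun W => ((isLocal_spinDensity _ _ U).mul
          (isLocal_kernelApply_glue γ θ Λ W f)).measurable.aestronglyMeasurable)
        (Eventually.of_forall fun W => Eventually.of_forall fun σ => hC γ Λ f M hM _ σ)
        (integrable_const _)
        (Eventually.of_forall fun σ =>
          (tendsto_kernelApply_directionLimit hmono hθ Λ σ hf).const_mul _)
    have h1 := le_of_tendsto_of_tendsto' (tendsto_integral_kernelApply_glue hmono hθ Λ hf
      (boundaryLimit γ η : Measure (L → S))) hlim fun W =>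
      integral_boundaryLimit_bot_le hmono hγ hθ hη h U (isLocal_kernelApply_glue γ θ Λ W f)
        (hmono.monotone_kernelApply_glue θ Λ W hf.measurable hm)
    have := (abs_le.1 hU).1
    linarith
  have hbot := (isConsistentWith_boundaryLimit_of_isBot hmono hγ hη).integral_kernelApply hγm Λ
    hf.measurable hM
  have iP : Integrable (kernelApply (directionLimit γ θ) Λ f)
      (boundaryLimit γ η : Measure (L → S)) :=
    integrable_of_abs_le (hγp.measurable_kernelApply' Λ hf.measurable) (abs_kernelApply_le hM Λ) _
  have iM : Integrable (kernelApply (directionLimit γ η) Λ f)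
      (boundaryLimit γ η : Measure (L → S)) :=
    integrable_of_abs_le (hγm.measurable_kernelApply' Λ hf.measurable) (abs_kernelApply_le hM Λ) _
  have hord : ∀ σ, kernelApply (directionLimit γ η) Λ f σ ≤
      kernelApply (directionLimit γ θ) Λ f σ :=
    fun σ => kernelApply_bot_le_top hmono hθ hη Λ σ hf hm
  have := (integral_eq_iff_of_ae_le iM iP (Eventually.of_forall hord)).1
    (le_antisymm (integral_mono iM iP hord) (hle.trans_eq hbot.symm))
  filter_upwards [this] with σ hσ using hσ.symm

theorem variational_principle_boundaryLimit (hmono : IsMonotonicityPreserving γ)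
    (hγ : IsSpecification γ) (hinv : IsInvariantFamily d γ) (hθ : IsTop θ) (hη : IsBot η)
    (h : HasRelEntropyDensity d o (boundaryLimit γ η) (boundaryLimit γ θ) 0) :
    IsConsistentWith (boundaryLimit γ η) (directionLimit γ θ) ∧
      (boundaryLimit γ η : Measure (L → S)) (continuitySet (directionLimit γ θ)) = 1 ∧
      (boundaryLimit γ η : Measure (L → S)) (continuitySet (directionLimit γ η)) = 1 ∧
      IsAlmostQuasilocal (boundaryLimit γ η) := by
  have hA := measure_agreementSet_boundaryLimit_bot hmono hγ hinv hθ hη h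
  have hμ : IsInvariantMeasure d (boundaryLimit γ η) :=
    @isInvariantMeasure_boundaryLimit L S d _ _ (dualLinearOrder S) _ _ _ _ γ η _ hmono.dual hγ
      hinv hη
  have h1 := isAlmostQuasilocal_of_agreement hmono hγ hinv hθ hη hμ h hA
  have h2 := measure_continuitySet_eq_one hmono hθ hη hA
  exact ⟨h1.1, h2.1, h2.2, h1.2⟩

end Variational

end LatticeSpin

/-! ### The theorem and its mirror image -/

theorem corollary3p3 {L S : Type*} [Countable L]
    [Finite S] [LinearOrder S] [BoundedOrder S]
    [TopologicalSpace S] [DiscreteTopology S] [MeasurableSpace S] [BorelSpace S]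
    (d : ℕ) [AddAction (Fin d → ℤ) L] [AddAction.IsPretransitive (Fin d → ℤ) L] (o : L)
    (γ : LatticeSpin.KernelFamily L S) (hspec : LatticeSpin.IsSpecification γ)
    (hmono : LatticeSpin.IsMonotonicityPreserving γ)
    (hinv : LatticeSpin.IsInvariantFamily d γ)
    (γp γm : LatticeSpin.KernelFamily L S) (μp μm : ProbabilityMeasure (L → S))
    (hγp : γp = LatticeSpin.directionLimit γ ⊤) (hγm : γm = LatticeSpin.directionLimit γ ⊥)
    (hμp : μp = LatticeSpin.boundaryLimit γ ⊤) (hμm : μm = LatticeSpin.boundaryLimit γ ⊥) :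
    -- the objects `γ^{(±)}` and `μ^±` are well defined
    (LatticeSpin.LimitsExist γ ⊤ ∧ LatticeSpin.LimitsExist γ ⊥) ∧
    -- (a)
    (LatticeSpin.HasRelEntropyDensity d o μm μp 0 →
      LatticeSpin.IsConsistentWith μm γp ∧
      (μm : Measure (L → S)) (LatticeSpin.continuitySet γp) = 1 ∧
      (μm : Measure (L → S)) (LatticeSpin.continuitySet γm) = 1 ∧
      LatticeSpin.IsAlmostQuasilocal μm) ∧
    -- (b)
    (∀ μ : ProbabilityMeasure (L → S), LatticeSpin.IsInvariantMeasure d μ →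
      LatticeSpin.HasRelEntropyDensity d o μ μp 0 →
      (μ : Measure (L → S)) (LatticeSpin.agreementSet γp γm) = 1 →
      LatticeSpin.IsConsistentWith μ γp ∧ LatticeSpin.IsAlmostQuasilocal μ) ∧
    -- (a) with `+` and `-` interchanged
    (LatticeSpin.HasRelEntropyDensity d o μp μm 0 →
      LatticeSpin.IsConsistentWith μp γm ∧
      (μp : Measure (L → S)) (LatticeSpin.continuitySet γm) = 1 ∧
      (μp : Measure (L → S)) (LatticeSpin.continuitySet γp) = 1 ∧
      LatticeSpin.IsAlmostQuasilocal μp) ∧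
    -- (b) with `+` and `-` interchanged
    (∀ μ : ProbabilityMeasure (L → S), LatticeSpin.IsInvariantMeasure d μ →
      LatticeSpin.HasRelEntropyDensity d o μ μm 0 →
      (μ : Measure (L → S)) (LatticeSpin.agreementSet γp γm) = 1 →
      LatticeSpin.IsConsistentWith μ γm ∧ LatticeSpin.IsAlmostQuasilocal μ) := by
  subst hγp hγm hμp hμm
  have htop : IsTop (⊤ : L → S) := fun _ => le_top
  have hbot : IsBot (⊥ : L → S) := fun _ => bot_le
  refine ⟨⟨LatticeSpin.limitsExist hmono hspec htop,
    LatticeSpin.limitsExist_of_isBot hmono hspec hbot⟩,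
    LatticeSpin.variational_principle_boundaryLimit hmono hspec hinv htop hbot,
    fun μ hμ h hA =>
      LatticeSpin.isAlmostQuasilocal_of_agreement hmono hspec hinv htop hbot hμ h hA,
    @LatticeSpin.variational_principle_boundaryLimit L S _ _ (LatticeSpin.dualLinearOrder S) _ _ _ _
      γ ⊥ ⊤ d _ _ o hmono.dual hspec hinv hbot htop,
    fun μ hμ h hA => ?_⟩
  rw [LatticeSpin.agreementSet_comm] at hA
  exact @LatticeSpin.isAlmostQuasilocal_of_agreement L S _ _ (LatticeSpin.dualLinearOrder S) _ _ _ _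
    γ ⊥ ⊤ d _ _ o μ hmono.dual hspec hinv hbot htop hμ h hA
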